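/- **Setting.** Let $\Omega\subset\mathbb R^d$ be open, bounded and convex with diameter $D$. Fix $M\ge 2$, $0<a_{\min}<1/M$, $\Delta_{\min}>0$ and $\varepsilon,\beta,\lambda>0$. Let $\mathcal M_M$ be the set of all $(a,x)\in\mathbb R^M\times\Omega^M$ with $a_m>a_{\min}$ for all $m$, $\sum_m a_m=1$ and $\|x_m-x_n\|>\Delta_{\min}$ for $m\ne n$. Put $\Xi(a,x)=\sum_m a_m\delta_{x_m}$ and let $\mathcal P_M=\Xi(\mathcal M_M)$. Let $$\mathrm{OT}_\varepsilon(\mu,\nu)=\min_{\pi}\int\tfrac12\|x-y\|^2d\pi+\varepsilon\,\mathrm{KL}(\pi\,|\,\mu\otimes\nu)$$ over the couplings $\pi$ of $\mu,\nu$, and $S_\varepsilon(\mu,\nu)=\mathrm{OT}_\varepsilon(\mu,\nu)-\frac12\mathrm{OT}_\varepsilon(\mu,\mu)-\frac12\mathrm{OT}_\varepsilon(\nu,\nu)$. The stored patterns are $X_j=\Xi(b_j,y_j)\in\mathcal P_M$, $j=1,\dots,N$, the energy is $E(\xi)=-\frac1\beta\log\sum_{j}e^{-\beta S_\varepsilon(\xi,X_j)}$,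 and $B_i(s)=\{\xi\in\mathcal P_M: S_\varepsilon(\xi,X_i)\le s\}$. For $(a,x)\in\mathcal M_M$ the tangent vectors are the $(\delta a,\delta x)\in\mathbb R^M\times(\mathbb R^d)^M$ with $\sum_m\delta a_m=0$, with the SHK inner product $\langle(\delta a,\delta x),(\delta a',\delta x')\rangle=\sum_m\big(\frac{\lambda^2}{a_m}\delta a_m\delta a'_m+a_m\,\delta x_m\cdot\delta x'_m\big)$ and norm $\|\cdot\|_{\rm SHK}$; $\operatorname{grad}E$ is the gradient of $E\circ\Xi$ for this metric. The retraction is $$\operatorname{Ret}_{(a,x)}(\delta a,\delta x)=\Big(\Big(\tfrac{a_me^{\delta a_m/a_m}}{\sum_j a_je^{\delta a_j/a_j}}\Big)_m,\ x+\delta x\Big),$$ on the domain of all tangent vectors with $\max_m|\delta a_m/a_m|<\frac12\min_m\log\frac{a_m}{a_{\min}}$ and $\max_m\|\delta x_m\|<\frac12\min\{\min_m\operatorname{dist}(x_m,\partial\Omega),\ \min_{m\ne n}\|x_m-x_n\|-\Delta_{\min}\}$. SHK gradient descent with step size $\eta$ is $z^{(k+1)}=\operatorname{Ret}_{z^{(k)}}(-\eta\operatorname{grad}E(z^{(k)}))$,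 $z^{(0)}\in\mathcal M_M$, and $\xi^{(k)}=\Xi(z^{(k)})$. **Assumptions.** Fix $i$. Let $w=\min_m(b_{i,m}-a_{\min})$, $d^\partial=\min_m\operatorname{dist}(y_{i,m},\partial\Omega)$, $s=\min_{m\neq n}\|y_{i,m}-y_{i,n}\|$. Let $0<\delta_i<\min\{d^\partial,\frac{s-\Delta_{\min}}2\}$, $0<\tau_i<w$ and $$0<r<\min\Big\{\tfrac{a_{\min}\delta_i^2}{2}-\varepsilon\log M,\ \tfrac{\tau_i(s-\delta_i)^2}{4}-\varepsilon\log M\Big\}.$$ Let $E^*=\inf_{B_i(r)}E$. Assume that for some $L,\mu>0$: (a) $E(\operatorname{Ret}_\xi(tv))\le E(\xi)+t\langle\operatorname{grad}E(\xi),v\rangle+\frac{Lt^2}{2}\|v\|_{\rm SHK}^2$ for all $\xi\in B_i(r)$, all tangent $v$ at $\xi$ and all $t>0$ such that $tv$ lies in the domain of the retraction; (b) $E$ has exactly one minimizer $X^*$ on $B_i(r)$; (c) $\frac12\|\operatorname{grad}E(\xi)\|_{\rm SHK}^2\ge\mu(E(\xi)-E^*)$ for all $\xi\in B_i(r)$.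 Put $\eta_{\rm ret}=\min\big\{\frac{\lambda^2}{2D^2}\log\frac{\min_mb_{i,m}-\tau_i}{a_{\min}},\ \frac1{2D}\min\{d^\partial-\delta_i,\ s-2\delta_i-\Delta_{\min}\}\big\}$, $G=D\sqrt{1+D^2/\lambda^2}$, $S_\eta=\min\{e^{\eta D^2/\lambda^2},a_{\min}^{-1/2}\}$ and $g_0=E(\xi^{(0)})-E^*$. Let $0<\eta<\min\{1/L,1/\mu,\eta_{\rm ret}\}$. **Conclusion.** For every $\xi\in B_i(r)$, $-\eta\operatorname{grad}E(\xi)$ lies in the domain of the retraction. If $\xi^{(k)}\in B_i(r)$ for all $k\ge0$, then: 1. for all $k\ge 0$, $$S_\varepsilon(\xi^{(k)},X^*)\le\frac{G\,S_\eta\sqrt{2\eta g_0}}{1-(1-\mu\eta)^{1/2}}\,(1-\eta\mu)^{k/2};$$ 2. $\xi^{(k)}$ converges weakly to $X^*$ in $\mathcal P(\Omega)$; 3. for every $\delta>0$, $S_\varepsilon(\xi^{(k)},X^*)\le\delta$ holds as soon as $$k\ge\frac{\min\{\frac{2\eta D^2}{\lambda^2},-\log a_{\min}\}+2\log G+\log(2\eta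 g_0)+2\log\frac{1}{\delta(1-\sqrt{1-\mu\eta})}}{-\log(1-\mu\eta)},$$ and also as soon as $$k\ge\min\Big\{\frac{2D^2}{\mu\lambda^2},-\frac{\log a_{\min}}{\mu\eta}\Big\}+\frac1{\mu\eta}\log(2\eta g_0)+\frac2{\mu\eta}\log\frac{2G}{\delta\mu\eta}$$ (if $g_0=0$, it holds for all $k\ge0$). Moreover, suppose $g_0>0$ and put $\rho=\frac{G\sqrt{2\eta g_0}}{\sqrt{a_{\min}}\,(1-\sqrt{1-\mu\eta})}$ and $\alpha=r^2\frac{\mu a_{\min}}{2G^2g_0}$. If $\alpha>1$, $\frac{4\alpha}{\mu(\alpha+1)^2}\le\eta$ and $\xi^{(0)}\in B_i(r-\rho)$, then $\xi^{(k)}\in B_i(r)$ for all $k\ge0$, and hence 1-3 hold without assuming it. -/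

import Mathlib

open MeasureTheory Filter Topology

noncomputable section

/-! ### Entropic optimal transport and the Sinkhorn divergence -/

/-- Couplings of `μ` and `ν`. -/
def couplings {d : ℕ} (μ ν : Measure (EuclideanSpace ℝ (Fin d))) :
    Set (Measure (EuclideanSpace ℝ (Fin d) × EuclideanSpace ℝ (Fin d))) :=
  {π | π.map Prod.fst = μ ∧ π.map Prod.snd = ν}

/-- Entropic optimal transport cost for the quadratic cost `c(x, y) = ‖x - y‖² / 2`:
the minimum over couplings `π` of `∫ c dπ + ε KL(π | μ ⊗ ν)`. -/
def entropicOT {d : ℕ} (ε : ℝ) (μ ν : Measure (EuclideanSpace ℝ (Fin d))) : ℝ :=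
  (⨅ π ∈ couplings μ ν,
    ((∫⁻ p, ENNReal.ofReal (‖p.1 - p.2‖ ^ 2 / 2) ∂π)
      + ENNReal.ofReal ε * InformationTheory.klDiv π (μ.prod ν))).toReal

/-- The debiased Sinkhorn divergence `S_ε(μ, ν)`. -/
def sinkhornDiv {d : ℕ} (ε : ℝ) (μ ν : Measure (EuclideanSpace ℝ (Fin d))) : ℝ :=
  entropicOT ε μ ν - entropicOT ε μ μ / 2 - entropicOT ε ν ν / 2

/-- The log-sum-exp energy `E(ξ) = -β⁻¹ log ∑ᵢ exp(-β S_ε(ξ, Xᵢ))`. -/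
def energy {d N : ℕ} (ε β : ℝ) (X : Fin N → Measure (EuclideanSpace ℝ (Fin d)))
    (ξ : Measure (EuclideanSpace ℝ (Fin d))) : ℝ :=
  -(1 / β) * Real.log (∑ i, Real.exp (-β * sinkhornDiv ε ξ (X i)))

/-! ### Weighted point clouds with `M` atoms -/

/-- Pairs `(a, x)` of `M` real numbers and `M` points of `ℝ^d`; also the ambient space of the
tangent vectors `(δa, δx)`. -/
abbrev Particles (d M : ℕ) : Type := (Fin M → ℝ) × (Fin M → EuclideanSpace ℝ (Fin d))

/-- Probability weights that are all larger than `amin`. -/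
def weightSpace (M : ℕ) (amin : ℝ) : Set (Fin M → ℝ) :=
  {a | (∀ m, amin < a m) ∧ ∑ m, a m = 1}

/-- `M` points of `Ω` at pairwise distance larger than `Δmin`. -/
def locSpace {d : ℕ} (M : ℕ) (Ω : Set (EuclideanSpace ℝ (Fin d))) (Δmin : ℝ) :
    Set (Fin M → EuclideanSpace ℝ (Fin d)) :=
  {x | (∀ m, x m ∈ Ω) ∧ ∀ m n, m ≠ n → Δmin < ‖x m - x n‖}

/-- The parameter space (ordered particles). -/
def paramSpace {d : ℕ} (M : ℕ) (Ω : Set (EuclideanSpace ℝ (Fin d))) (amin Δmin : ℝ) :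
    Set (Particles d M) :=
  weightSpace M amin ×ˢ locSpace M Ω Δmin

/-- The discrete measure `∑ₘ aₘ δ_{xₘ}`. -/
def toMeasure {d M : ℕ} (z : Particles d M) : Measure (EuclideanSpace ℝ (Fin d)) :=
  ∑ m, ENNReal.ofReal (z.1 m) • Measure.dirac (z.2 m)

/-- The probability measures on `Ω` with `M` atoms that are pairwise `Δmin`-separated and have
masses larger than `amin`. -/
def atomicMeasures {d : ℕ} (M : ℕ) (Ω : Set (EuclideanSpace ℝ (Fin d))) (amin Δmin : ℝ) :
    Set (Measure (EuclideanSpace ℝ (Fin d))) :=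
  toMeasure '' paramSpace M Ω amin Δmin

/-- The local basin `{ξ : S_ε(ξ, X) ≤ r}` of the stored pattern `X`. -/
def basin {d : ℕ} (M : ℕ) (Ω : Set (EuclideanSpace ℝ (Fin d))) (amin Δmin ε : ℝ)
    (X : Measure (EuclideanSpace ℝ (Fin d))) (r : ℝ) :
    Set (Measure (EuclideanSpace ℝ (Fin d))) :=
  {ξ | ξ ∈ atomicMeasures M Ω amin Δmin ∧ sinkhornDiv ε ξ X ≤ r}

/-- `min_m dist(x_m, ∂Ω)`. -/
def distBoundary {d M : ℕ} (Ω : Set (EuclideanSpace ℝ (Fin d)))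
    (x : Fin M → EuclideanSpace ℝ (Fin d)) : ℝ :=
  ⨅ m, Metric.infDist (x m) (frontier Ω)

/-- `min_{m ≠ n} ‖x_m - x_n‖` (used for `M ≥ 2`). -/
def sep {d M : ℕ} (x : Fin M → EuclideanSpace ℝ (Fin d)) : ℝ :=
  ⨅ p : {p : Fin M × Fin M // p.1 ≠ p.2}, ‖x p.1.1 - x p.1.2‖

/-! ### The spherical Hellinger-Kantorovich geometry -/

/-- Tangent vectors: `∑ₘ δaₘ = 0`. -/
def tangentSpace (d M : ℕ) : Set (Particles d M) :=
  {w | ∑ m, w.1 m = 0}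

/-- The SHK metric tensor at `z = (a, x)`. -/
def shkInner {d M : ℕ} (lam : ℝ) (z v w : Particles d M) : ℝ :=
  ∑ m, (lam ^ 2 / z.1 m * (v.1 m * w.1 m) + z.1 m * inner ℝ (v.2 m) (w.2 m))

/-- The SHK norm at `z = (a, x)`. -/
def shkNorm {d M : ℕ} (lam : ℝ) (z v : Particles d M) : ℝ :=
  Real.sqrt (shkInner lam z v v)

/-- `v` is the Riemannian (SHK) gradient at `z` of a functional `F` of measures: it is tangent, and
`⟨v, w⟩_z = d(F ∘ toMeasure)_z[w]` for every tangent `w`. The differential is taken along the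
parameter space. -/
def IsSHKGrad {d M : ℕ} (Ω : Set (EuclideanSpace ℝ (Fin d))) (amin Δmin lam : ℝ)
    (F : Measure (EuclideanSpace ℝ (Fin d)) → ℝ) (z v : Particles d M) : Prop :=
  v ∈ tangentSpace d M ∧
    ∃ A : Particles d M →L[ℝ] ℝ,
      HasFDerivWithinAt (fun p : Particles d M => F (toMeasure p)) A
        (paramSpace M Ω amin Δmin) z ∧
      ∀ w ∈ tangentSpace d M, shkInner lam z v w = A w

open Classical in
/-- The SHK gradient of `F` at `z` (unique where it exists; `0` where it does not exist). -/
def shkGrad {d M : ℕ} (Ω : Set (EuclideanSpace ℝ (Fin d))) (amin Δmin lam : ℝ)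
    (F : Measure (EuclideanSpace ℝ (Fin d)) → ℝ) (z : Particles d M) : Particles d M :=
  if h : ∃ v, IsSHKGrad Ω amin Δmin lam F z v then h.choose else 0

/-- The product retraction: multiplicative normalized update of the weights, additive update of
the locations. -/
def retraction {d M : ℕ} (z w : Particles d M) : Particles d M :=
  (fun m => z.1 m * Real.exp (w.1 m / z.1 m) / ∑ j, z.1 j * Real.exp (w.1 j / z.1 j),
    fun m => z.2 m + w.2 m)

/-- The set of tangent vectors at `z = (a, x)` on which the retraction is (well-)defined:
`‖δa / a‖_∞ < ½ min_m log (a_m / amin)` and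
`max_m ‖δx_m‖ < ½ min (d_∂(x), sep(x) - Δmin)`. -/
def retractionDomain {d M : ℕ} (Ω : Set (EuclideanSpace ℝ (Fin d))) (amin Δmin : ℝ)
    (z : Particles d M) : Set (Particles d M) :=
  {w | w ∈ tangentSpace d M ∧
    (∀ m, |w.1 m / z.1 m| < 1 / 2 * ⨅ k, Real.log (z.1 k / amin)) ∧
    ∀ m, ‖w.2 m‖ < 1 / 2 * min (distBoundary Ω z.2) (sep z.2 - Δmin)}

/-- One SHK gradient descent step for `F` with step size `η`, on ordered particles. -/
def shkStep {d M : ℕ} (Ω : Set (EuclideanSpace ℝ (Fin d))) (amin Δmin lam : ℝ)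
    (F : Measure (EuclideanSpace ℝ (Fin d)) → ℝ) (η : ℝ) (z : Particles d M) : Particles d M :=
  retraction z (-(η • shkGrad Ω amin Δmin lam F z))

/-! ### Local assumptions on a set `B` of measures -/

/-- Local retraction `L`-smoothness of `F` on `B` in the SHK geometry. -/
def RetractionSmoothOn {d : ℕ} (M : ℕ) (Ω : Set (EuclideanSpace ℝ (Fin d))) (amin Δmin lam : ℝ)
    (F : Measure (EuclideanSpace ℝ (Fin d)) → ℝ) (B : Set (Measure (EuclideanSpace ℝ (Fin d))))
    (L : ℝ) : Prop :=
  ∀ z ∈ paramSpace M Ω amin Δmin, toMeasure z ∈ B → ∀ w ∈ tangentSpace d M, ∀ t : ℝ, 0 < t →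
    t • w ∈ retractionDomain Ω amin Δmin z →
    F (toMeasure (retraction z (t • w))) ≤ F (toMeasure z)
      + t * shkInner lam z (shkGrad Ω amin Δmin lam F z) w
      + L * t ^ 2 / 2 * shkNorm lam z w ^ 2

/-- `Xs` is a minimizer of `F` on `B`, and the only one. -/
def IsUniqueMinOn {d : ℕ} (F : Measure (EuclideanSpace ℝ (Fin d)) → ℝ)
    (B : Set (Measure (EuclideanSpace ℝ (Fin d)))) (Xs : Measure (EuclideanSpace ℝ (Fin d))) :
    Prop :=
  Xs ∈ B ∧ IsMinOn F B Xs ∧ ∀ ξ ∈ B, IsMinOn F B ξ → ξ = Xs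

/-- The Polyak-Lojasiewicz inequality on `B` with constant `μ` and reference value `inf_B F`. -/
def PLOn {d : ℕ} (M : ℕ) (Ω : Set (EuclideanSpace ℝ (Fin d))) (amin Δmin lam : ℝ)
    (F : Measure (EuclideanSpace ℝ (Fin d)) → ℝ) (B : Set (Measure (EuclideanSpace ℝ (Fin d))))
    (μ : ℝ) : Prop :=
  ∀ z ∈ paramSpace M Ω amin Δmin, toMeasure z ∈ B →
    μ * (F (toMeasure z) - sInf (F '' B)) ≤
      1 / 2 * shkNorm lam z (shkGrad Ω amin Δmin lam F z) ^ 2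

/-! ### Explicit constants -/

/-- `w = min_m (b_m - amin)`. -/
def weightMargin {M : ℕ} (amin : ℝ) (b : Fin M → ℝ) : ℝ := ⨅ m, (b m - amin)

/-- `r^loc(δ, τ)` for a pattern with separation `s`. -/
def rLoc (M : ℕ) (amin ε s δ τ : ℝ) : ℝ :=
  min (amin * δ ^ 2 / 2 - ε * Real.log M) (τ * (s - δ) ^ 2 / 4 - ε * Real.log M)

/-- The retraction step-size threshold `η_ret` of the pattern with parameters `p = (b, y)`. -/
def etaRet {d M : ℕ} (Ω : Set (EuclideanSpace ℝ (Fin d))) (amin Δmin lam δ τ : ℝ)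
    (p : Particles d M) : ℝ :=
  min (lam ^ 2 / (2 * Metric.diam Ω ^ 2) * Real.log (((⨅ m, p.1 m) - τ) / amin))
    (1 / (2 * Metric.diam Ω) * min (distBoundary Ω p.2 - δ) (sep p.2 - 2 * δ - Δmin))

/-- `G = D √(1 + D² / λ²)`. -/
def gradBound (D lam : ℝ) : ℝ := D * Real.sqrt (1 + D ^ 2 / lam ^ 2)

/-- `S_η = min (exp (η D² / λ²), 1 / √amin)`. -/
def stepFactor (D lam amin η : ℝ) : ℝ :=
  min (Real.exp (η * D ^ 2 / lam ^ 2)) (1 / Real.sqrt amin)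

/-- `ρ = G √(2 η gap) / (√amin (1 - √(1 - μ η)))`. -/
def rhoRadius (D lam amin μ η gap : ℝ) : ℝ :=
  gradBound D lam * (Real.sqrt (2 * η * gap) / (Real.sqrt amin * (1 - Real.sqrt (1 - μ * η))))

/-- `α = r² μ amin / (2 G² gap)`. -/
def alphaRatio (D lam amin μ r gap : ℝ) : ℝ :=
  r ^ 2 * (μ * amin / (2 * gradBound D lam ^ 2 * gap))

/-! ### Conclusions -/

/-- Weak convergence in the space of probability measures on `Ω`, for measures given on the
ambient space. -/
def WeaklyConvergesIn {d : ℕ} (Ω : Set (EuclideanSpace ℝ (Fin d)))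
    (ξ : ℕ → Measure (EuclideanSpace ℝ (Fin d))) (ξ' : Measure (EuclideanSpace ℝ (Fin d))) :
    Prop :=
  ∃ (P : ℕ → ProbabilityMeasure Ω) (Q : ProbabilityMeasure Ω),
    (∀ k, (P k : Measure Ω).map Subtype.val = ξ k) ∧ (Q : Measure Ω).map Subtype.val = ξ' ∧
      Tendsto P atTop (𝓝 Q)

/-- The geometric bound on `S_ε(ξ^(k), Xs)`; `gap` is the initial energy gap. -/
def GeometricBound {d : ℕ} (ε D lam amin μ η gap : ℝ)
    (ξ : ℕ → Measure (EuclideanSpace ℝ (Fin d))) (Xs : Measure (EuclideanSpace ℝ (Fin d))) :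
    Prop :=
  ∀ k : ℕ, sinkhornDiv ε (ξ k) Xs ≤
    gradBound D lam * stepFactor D lam amin η * Real.sqrt (2 * η * gap)
      / (1 - (1 - μ * η) ^ (1 / 2 : ℝ)) * (1 - η * μ) ^ ((k : ℝ) / 2)

/-- The two iteration-complexity bounds for accuracy `acc`. -/
def IterationComplexity {d : ℕ} (ε D lam amin μ η gap : ℝ)
    (ξ : ℕ → Measure (EuclideanSpace ℝ (Fin d))) (Xs : Measure (EuclideanSpace ℝ (Fin d))) :
    Prop :=
  ∀ acc : ℝ, 0 < acc → ∀ k : ℕ,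
    ((min (2 * η * D ^ 2 / lam ^ 2) (-Real.log amin) + 2 * Real.log (gradBound D lam)
        + Real.log (2 * η * gap) + 2 * Real.log (1 / (acc * (1 - Real.sqrt (1 - μ * η)))))
        / (-Real.log (1 - μ * η)) ≤ k →
      sinkhornDiv ε (ξ k) Xs ≤ acc) ∧
    (min (2 * D ^ 2 / (μ * lam ^ 2)) (-(Real.log amin / (μ * η)))
        + 1 / (μ * η) * Real.log (2 * η * gap)
        + 2 / (μ * η) * Real.log (2 * gradBound D lam / (acc * μ * η)) ≤ k →
      sinkhornDiv ε (ξ k) Xs ≤ acc)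

end

/-!
The proof uses no derivatives of the transport cost. Entropic optimal transport between discrete
measures has optimal potentials, obtained as the minimizer of a coercive semi-dual functional
(`exists_log_scalings`), and weak duality is Gibbs' inequality (`dual_le_entropicOT`). Testing the
dual problem at one pair of measures with the potentials of another one bounds the increments of
`S_ε(·, ν)` by the integral of `f_{μ'ν} - f_{μμ'} / 2 - f_{μμ} / 2`. Every potential is a soft
minimum of the costs `‖x - y‖² / 2`, so the quadratic terms cancel in this combination, which is
thus `diam Ω`-Lipschitz (`sinkhornDiv_sub_le`). Hence `S_ε(·, ν)`, and the energy with it, is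
Lipschitz along particle moves, with the explicit modulus `transportBound`.

This single estimate yields the bounds `|δa / a| ≤ D² / λ²` and `‖δx‖ ≤ D` for the SHK gradient, by
difference quotients (`shkGrad_bounds`), the continuity of all functionals, and the bound
`G S_η ‖v‖_SHK` for the change of `S_ε(·, ν)` in a retraction step `v`
(`transportBound_retraction_le`). Since the dual problem may also be tested with potentials that
live on single atoms, a point of the basin has its atoms close to those of the pattern and its
weights not much smaller (`basin_margins`); so gradient steps stay in the domain of the retraction.

Smoothness and the Polyak-Lojasiewicz inequality give the geometric decay of the energy gap, and of
the step lengths, which are at most the square root of the gap. The particles therefore form a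
Cauchy sequence. The margins of the basin keep the limit in the parameter space, where it has
minimal energy, hence represents the minimizer, and summing the increments of `S_ε(·, X*)` gives
the geometric bound. For a start in the smaller basin the same sum shows that the divergence to the
pattern never reaches `r` along the curves `t ↦ Ret(-t grad E)`, `t ≤ η`, as long as they stay in
the basin; by continuity they do.
-/

noncomputable section

/-! ### Discrete measures -/

lemma isProbabilityMeasure_toMeasure {d M : ℕ} {z : Particles d M} (hz : z.1 ∈ weightSpace M 0) :
    IsProbabilityMeasure (toMeasure z) := by
  refine ⟨?_⟩
  simp only [toMeasure, Measure.finsetSum_apply, Measure.smul_apply, measure_univ, smul_eq_mul,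
    mul_one]
  rw [← ENNReal.ofReal_sum_of_nonneg (fun m _ => (hz.1 m).le), hz.2, ENNReal.ofReal_one]

instance isFiniteMeasure_toMeasure {d M : ℕ} (z : Particles d M) :
    IsFiniteMeasure (toMeasure z) := by
  refine ⟨?_⟩
  simp only [toMeasure, Measure.finsetSum_apply, Measure.smul_apply, measure_univ, smul_eq_mul,
    mul_one]
  exact ENNReal.sum_lt_top.2 fun m _ => ENNReal.ofReal_lt_top

lemma integrable_toMeasure {d M : ℕ} (z : Particles d M) (f : EuclideanSpace ℝ (Fin d) → ℝ) :
    Integrable f (toMeasure z) := by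
  rw [toMeasure, integrable_finsetSum_measure]
  exact fun m _ => (integrable_dirac enorm_lt_top).smul_measure ENNReal.ofReal_ne_top

lemma integral_toMeasure {d M : ℕ} {z : Particles d M} (hz : z.1 ∈ weightSpace M 0)
    (f : EuclideanSpace ℝ (Fin d) → ℝ) :
    ∫ x, f x ∂toMeasure z = ∑ m, z.1 m * f (z.2 m) := by
  rw [toMeasure, integral_finsetSum_measure
    (fun m _ => (integrable_dirac enorm_lt_top).smul_measure ENNReal.ofReal_ne_top)]
  refine Finset.sum_congr rfl fun m _ => ?_
  rw [integral_smul_measure, integral_dirac, ENNReal.toReal_ofReal (hz.1 m).le, smul_eq_mul]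

lemma lintegral_toMeasure {d M : ℕ} (z : Particles d M)
    (f : EuclideanSpace ℝ (Fin d) → ENNReal) :
    ∫⁻ x, f x ∂toMeasure z = ∑ m, ENNReal.ofReal (z.1 m) * f (z.2 m) := by
  rw [toMeasure, lintegral_finsetSum_measure]
  simp

lemma toMeasure_prod {d M K : ℕ} (z : Particles d M) (w : Particles d K) :
    (toMeasure z).prod (toMeasure w) =
      ∑ q : Fin M × Fin K, (ENNReal.ofReal (z.1 q.1) * ENNReal.ofReal (w.1 q.2)) •
        Measure.dirac (z.2 q.1, w.2 q.2) := by
  rw [toMeasure, toMeasure, ← Measure.sum_fintype, ← Measure.sum_fintype, Measure.prod_sum,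
    Measure.sum_fintype]
  refine Finset.sum_congr rfl fun q _ => ?_
  rw [Measure.prod_smul_left, Measure.prod_smul_right, Measure.dirac_prod_dirac, smul_smul]

lemma integrable_toMeasure_prod {d M K : ℕ} (z : Particles d M) (w : Particles d K)
    (f : EuclideanSpace ℝ (Fin d) × EuclideanSpace ℝ (Fin d) → ℝ) :
    Integrable f ((toMeasure z).prod (toMeasure w)) := by
  rw [toMeasure_prod, integrable_finsetSum_measure]
  exact fun q _ => (integrable_dirac enorm_lt_top).smul_measure
    (ENNReal.mul_ne_top ENNReal.ofReal_ne_top ENNReal.ofReal_ne_top)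

lemma integral_toMeasure_prod {d M K : ℕ} {z : Particles d M} {w : Particles d K}
    (hz : z.1 ∈ weightSpace M 0) (hw : w.1 ∈ weightSpace K 0)
    (f : EuclideanSpace ℝ (Fin d) × EuclideanSpace ℝ (Fin d) → ℝ) :
    ∫ x, f x ∂((toMeasure z).prod (toMeasure w)) =
      ∑ m, ∑ n, z.1 m * w.1 n * f (z.2 m, w.2 n) := by
  rw [toMeasure_prod, integral_finsetSum_measure
    (fun q _ => (integrable_dirac enorm_lt_top).smul_measure
      (ENNReal.mul_ne_top ENNReal.ofReal_ne_top ENNReal.ofReal_ne_top)), Fintype.sum_prod_type]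
  refine Finset.sum_congr rfl fun m _ => Finset.sum_congr rfl fun n _ => ?_
  rw [integral_smul_measure, integral_dirac, ← ENNReal.ofReal_mul (hz.1 m).le,
    ENNReal.toReal_ofReal (mul_pos (hz.1 m) (hw.1 n)).le, smul_eq_mul]

/-! ### Duality for entropic optimal transport -/

/-- The quadratic transport cost. -/
def quadCost {d : ℕ} (x y : EuclideanSpace ℝ (Fin d)) : ℝ := ‖x - y‖ ^ 2 / 2

lemma quadCost_nonneg {d : ℕ} (x y : EuclideanSpace ℝ (Fin d)) : 0 ≤ quadCost x y := by
  unfold quadCost; positivity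

lemma quadCost_comm {d : ℕ} (x y : EuclideanSpace ℝ (Fin d)) : quadCost x y = quadCost y x := by
  unfold quadCost; rw [norm_sub_rev]

lemma continuous_quadCost {d : ℕ} : Continuous fun q : EuclideanSpace ℝ (Fin d) ×
    EuclideanSpace ℝ (Fin d) => quadCost q.1 q.2 := by
  unfold quadCost; fun_prop

/-- The dual objective bounds the cost of every coupling from below. The reason is Gibbs'
inequality `KL(π | ρ_F) ≥ 0` for `ρ_F` the product measure tilted by `F = (f ⊕ g - c) / ε`. -/
lemma dual_le_coupling_cost {d M K : ℕ} {ε : ℝ} (hε : 0 < ε) {z : Particles d M}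
    {w : Particles d K} (hz : z.1 ∈ weightSpace M 0) (hw : w.1 ∈ weightSpace K 0)
    {f g : EuclideanSpace ℝ (Fin d) → ℝ} (hf : Measurable f) (hg : Measurable g)
    (h : ∑ m, ∑ n, z.1 m * w.1 n *
      Real.exp ((f (z.2 m) + g (w.2 n) - quadCost (z.2 m) (w.2 n)) / ε) ≤ 1)
    {π : Measure (EuclideanSpace ℝ (Fin d) × EuclideanSpace ℝ (Fin d))}
    (hπ : π ∈ couplings (toMeasure z) (toMeasure w)) :
    ENNReal.ofReal (∑ m, z.1 m * f (z.2 m) + ∑ n, w.1 n * g (w.2 n)) ≤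
      (∫⁻ p, ENNReal.ofReal (‖p.1 - p.2‖ ^ 2 / 2) ∂π)
      + ENNReal.ofReal ε * InformationTheory.klDiv π ((toMeasure z).prod (toMeasure w)) := by
  have hpz := isProbabilityMeasure_toMeasure hz
  have hpw := isProbabilityMeasure_toMeasure hw
  set ρ := (toMeasure z).prod (toMeasure w) with hρ
  have hpπ : IsProbabilityMeasure π := by
    refine ⟨?_⟩
    have := congrArg (fun m => m Set.univ) hπ.1
    simpa [Measure.map_apply measurable_fst MeasurableSet.univ] using this
  by_cases hc : ∫⁻ p, ENNReal.ofReal (quadCost p.1 p.2) ∂π = ⊤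
  · unfold quadCost at hc
    rw [hc, top_add]; exact le_top
  by_cases hk : InformationTheory.klDiv π ρ = ⊤
  · rw [hk, ENNReal.mul_top (by simpa using hε), add_top]; exact le_top
  obtain ⟨hac, hint⟩ := InformationTheory.klDiv_ne_top_iff.1 hk
  have hcint : Integrable (fun q : EuclideanSpace ℝ (Fin d) × EuclideanSpace ℝ (Fin d) =>
      quadCost q.1 q.2) π := by
    refine (lintegral_ofReal_ne_top_iff_integrable
      continuous_quadCost.aestronglyMeasurable
      (Eventually.of_forall fun q => quadCost_nonneg _ _)).1 hc
  have hfm : Integrable (fun q : EuclideanSpace ℝ (Fin d) × EuclideanSpace ℝ (Fin d) =>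
      f q.1) π := by
    have := integrable_toMeasure z f
    rw [← hπ.1] at this
    exact this.comp_measurable measurable_fst
  have hgm : Integrable (fun q : EuclideanSpace ℝ (Fin d) × EuclideanSpace ℝ (Fin d) =>
      g q.2) π := by
    have := integrable_toMeasure w g
    rw [← hπ.2] at this
    exact this.comp_measurable measurable_snd
  have hfi : ∫ q, f q.1 ∂π = ∑ m, z.1 m * f (z.2 m) := by
    rw [← integral_toMeasure hz, ← hπ.1, integral_map measurable_fst.aemeasurable
      hf.aestronglyMeasurable]
  have hgi : ∫ q, g q.2 ∂π = ∑ m, w.1 m * g (w.2 m) := by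
    rw [← integral_toMeasure hw, ← hπ.2, integral_map measurable_snd.aemeasurable
      hg.aestronglyMeasurable]
  set F : EuclideanSpace ℝ (Fin d) × EuclideanSpace ℝ (Fin d) → ℝ :=
    fun q => (f q.1 + g q.2 - quadCost q.1 q.2) / ε with hF
  have hFint : Integrable F π := ((hfm.add hgm).sub hcint).div_const ε
  have hFi : ∫ q, F q ∂π = (∑ m, z.1 m * f (z.2 m) + ∑ n, w.1 n * g (w.2 n)
      - ∫ q, quadCost q.1 q.2 ∂π) / ε := by
    have hfg : Integrable (fun q : EuclideanSpace ℝ (Fin d) × EuclideanSpace ℝ (Fin d) =>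
        f q.1 + g q.2) π := hfm.add hgm
    rw [hF, integral_div, integral_sub hfg hcint, integral_add hfm hgm, hfi, hgi]
  have hexp : Integrable (fun q => Real.exp (F q)) ρ := integrable_toMeasure_prod z w _
  have hexpi : ∫ q, Real.exp (F q) ∂ρ ≤ 1 := by
    rw [hρ, integral_toMeasure_prod hz hw]; exact h
  have hprob := isProbabilityMeasure_tilted hexp
  have hnn := InformationTheory.integral_llr_add_sub_measure_univ_nonneg
    (hac.trans (absolutelyContinuous_tilted hexp))
    (integrable_llr_tilted_right hac hFint hint hexp)
  rw [integral_llr_tilted_right hac hFint hexp hint] at hnn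
  simp only [probReal_univ] at hnn
  have hlog : Real.log (∫ q, Real.exp (F q) ∂ρ) ≤ 0 :=
    Real.log_nonpos (integral_nonneg fun q => (Real.exp_pos _).le) hexpi
  have hkey : (∑ m, z.1 m * f (z.2 m) + ∑ n, w.1 n * g (w.2 n)) ≤
      ∫ q, quadCost q.1 q.2 ∂π + ε * ∫ q, llr π ρ q ∂π := by
    have h1 : ∫ q, F q ∂π ≤ ∫ q, llr π ρ q ∂π := by linarith
    rw [hFi, div_le_iff₀ hε] at h1
    linarith
  rw [InformationTheory.klDiv_of_ac_of_integrable hac hint]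
  simp only [probReal_univ, add_sub_cancel_right]
  rw [← ENNReal.ofReal_mul hε.le]
  change _ ≤ ∫⁻ p, ENNReal.ofReal (quadCost p.1 p.2) ∂π + _
  rw [← ofReal_integral_eq_lintegral_ofReal hcint
    (Eventually.of_forall fun q => quadCost_nonneg _ _)]
  exact (ENNReal.ofReal_le_ofReal hkey).trans ENNReal.ofReal_add_le

lemma entropicOT_iInf_ne_top {d M K : ℕ} (ε : ℝ) {z : Particles d M}
    {w : Particles d K} (hz : z.1 ∈ weightSpace M 0) (hw : w.1 ∈ weightSpace K 0) :
    (⨅ π ∈ couplings (toMeasure z) (toMeasure w),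
    ((∫⁻ p, ENNReal.ofReal (‖p.1 - p.2‖ ^ 2 / 2) ∂π)
      + ENNReal.ofReal ε * InformationTheory.klDiv π ((toMeasure z).prod (toMeasure w)))) ≠ ⊤ := by
  have hpz := isProbabilityMeasure_toMeasure hz
  have hpw := isProbabilityMeasure_toMeasure hw
  refine ne_top_of_le_ne_top ?_ (iInf₂_le ((toMeasure z).prod (toMeasure w)) ?_)
  · rw [InformationTheory.klDiv_self, mul_zero, add_zero]
    exact (integrable_toMeasure_prod z w fun q => ‖q.1 - q.2‖ ^ 2 / 2).lintegral_lt_top.ne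
  · constructor
    · simp
    · simp

/-- Weak duality for entropic optimal transport between discrete measures. -/
lemma dual_le_entropicOT {d M K : ℕ} {ε : ℝ} (hε : 0 < ε) {z : Particles d M}
    {w : Particles d K} (hz : z.1 ∈ weightSpace M 0) (hw : w.1 ∈ weightSpace K 0)
    {f g : EuclideanSpace ℝ (Fin d) → ℝ} (hf : Measurable f) (hg : Measurable g)
    (h : ∑ m, ∑ n, z.1 m * w.1 n *
      Real.exp ((f (z.2 m) + g (w.2 n) - quadCost (z.2 m) (w.2 n)) / ε) ≤ 1) :
    ∑ m, z.1 m * f (z.2 m) + ∑ n, w.1 n * g (w.2 n) ≤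
      entropicOT ε (toMeasure z) (toMeasure w) := by
  rw [entropicOT, ← ENNReal.ofReal_le_iff_le_toReal (entropicOT_iInf_ne_top ε hz hw)]
  exact le_iInf₂ fun π hπ => dual_le_coupling_cost hε hz hw hf hg h hπ

/-- Strong duality: potentials that solve both Schrödinger equations attain the dual value. The
optimal coupling is the product measure tilted by `(f ⊕ g - c) / ε`. -/
lemma entropicOT_eq_dual {d M K : ℕ} {ε : ℝ} (hε : 0 < ε) {z : Particles d M}
    {w : Particles d K} (hz : z.1 ∈ weightSpace M 0) (hw : w.1 ∈ weightSpace K 0)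
    {f g : EuclideanSpace ℝ (Fin d) → ℝ} (hf : Measurable f) (hg : Measurable g)
    (h₁ : ∀ x, ∑ n, w.1 n * Real.exp ((f x + g (w.2 n) - quadCost x (w.2 n)) / ε) = 1)
    (h₂ : ∀ y, ∑ m, z.1 m * Real.exp ((f (z.2 m) + g y - quadCost (z.2 m) y) / ε) = 1) :
    entropicOT ε (toMeasure z) (toMeasure w) =
      ∑ m, z.1 m * f (z.2 m) + ∑ n, w.1 n * g (w.2 n) := by
  have hpz := isProbabilityMeasure_toMeasure hz
  have hpw := isProbabilityMeasure_toMeasure hw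
  have hsum : ∑ m, ∑ n, z.1 m * w.1 n *
      Real.exp ((f (z.2 m) + g (w.2 n) - quadCost (z.2 m) (w.2 n)) / ε) = 1 := by
    simp_rw [mul_assoc, ← Finset.mul_sum, h₁, mul_one]
    exact hz.2
  refine le_antisymm ?_ (dual_le_entropicOT hε hz hw hf hg hsum.le)
  set ρ := (toMeasure z).prod (toMeasure w) with hρ
  set F : EuclideanSpace ℝ (Fin d) × EuclideanSpace ℝ (Fin d) → ℝ :=
    fun q => (f q.1 + g q.2 - quadCost q.1 q.2) / ε with hF
  have hFm : Measurable F :=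
    (((hf.comp measurable_fst).add (hg.comp measurable_snd)).sub
      continuous_quadCost.measurable).div_const ε
  have hexp : Integrable (fun q => Real.exp (F q)) ρ := integrable_toMeasure_prod z w _
  have hexpi : ∫ q, Real.exp (F q) ∂ρ = 1 := by
    rw [hρ, integral_toMeasure_prod hz hw]; exact hsum
  have hprob := isProbabilityMeasure_tilted hexp
  set π := ρ.tilted F with hπdef
  have hφm : Measurable fun q => ENNReal.ofReal (Real.exp (F q)) :=
    ENNReal.measurable_ofReal.comp (Real.measurable_exp.comp hFm)
  have hπd : π = ρ.withDensity fun q => ENNReal.ofReal (Real.exp (F q)) := by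
    rw [hπdef, Measure.tilted, hexpi]; simp
  have hin₁ : ∀ x, ∫⁻ y, ENNReal.ofReal (Real.exp (F (x, y))) ∂toMeasure w = 1 := by
    intro x
    rw [lintegral_toMeasure, ← ENNReal.ofReal_one, ← h₁ x, ENNReal.ofReal_sum_of_nonneg
      fun n _ => mul_nonneg (hw.1 n).le (Real.exp_pos _).le]
    exact Finset.sum_congr rfl fun n _ => (ENNReal.ofReal_mul (hw.1 n).le).symm
  have hin₂ : ∀ y, ∫⁻ x, ENNReal.ofReal (Real.exp (F (x, y))) ∂toMeasure z = 1 := by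
    intro y
    rw [lintegral_toMeasure, ← ENNReal.ofReal_one, ← h₂ y, ENNReal.ofReal_sum_of_nonneg
      fun n _ => mul_nonneg (hz.1 n).le (Real.exp_pos _).le]
    exact Finset.sum_congr rfl fun n _ => (ENNReal.ofReal_mul (hz.1 n).le).symm
  have hπ : π ∈ couplings (toMeasure z) (toMeasure w) := by
    constructor
    · refine Measure.ext fun s hs => ?_
      rw [Measure.map_apply measurable_fst hs, hπd, withDensity_apply _ (measurable_fst hs),
        ← lintegral_indicator (measurable_fst hs), hρ,
        lintegral_prod _ (hφm.indicator (measurable_fst hs)).aemeasurable]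
      have : ∀ x, ∫⁻ y, (Prod.fst ⁻¹' s).indicator
          (fun q => ENNReal.ofReal (Real.exp (F q))) (x, y) ∂toMeasure w = s.indicator 1 x := by
        intro x
        by_cases hx : x ∈ s
        · simp [Set.indicator, hx, hin₁]
        · simp [Set.indicator, hx]
      simp_rw [this]
      exact lintegral_indicator_one hs
    · refine Measure.ext fun s hs => ?_
      rw [Measure.map_apply measurable_snd hs, hπd, withDensity_apply _ (measurable_snd hs),
        ← lintegral_indicator (measurable_snd hs), hρ,
        lintegral_prod_symm _ (hφm.indicator (measurable_snd hs)).aemeasurable]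
      have : ∀ y, ∫⁻ x, (Prod.snd ⁻¹' s).indicator
          (fun q => ENNReal.ofReal (Real.exp (F q))) (x, y) ∂toMeasure z = s.indicator 1 y := by
        intro x
        by_cases hx : x ∈ s
        · simp [Set.indicator, hx, hin₂]
        · simp [Set.indicator, hx]
      simp_rw [this]
      exact lintegral_indicator_one hs
  have hac : π ≪ ρ := tilted_absolutelyContinuous ρ F
  have hπint : ∀ u : EuclideanSpace ℝ (Fin d) × EuclideanSpace ℝ (Fin d) → ℝ,
      Integrable u π := fun u =>
    (integrable_tilted_iff hexp u).2 (integrable_toMeasure_prod z w _)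
  have hllr : llr π ρ =ᵐ[π] F := by
    have := log_rnDeriv_tilted_left_self hexp
    rw [hexpi, Real.log_one] at this
    simpa [llr_def] using hac.ae_eq this
  have hint : Integrable (llr π ρ) π := (integrable_congr hllr).2 (hπint F)
  have hfi : ∫ q, f q.1 ∂π = ∑ m, z.1 m * f (z.2 m) := by
    rw [← integral_toMeasure hz, ← hπ.1, integral_map measurable_fst.aemeasurable
      hf.aestronglyMeasurable]
  have hgi : ∫ q, g q.2 ∂π = ∑ m, w.1 m * g (w.2 m) := by
    rw [← integral_toMeasure hw, ← hπ.2, integral_map measurable_snd.aemeasurable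
      hg.aestronglyMeasurable]
  have hFi : ∫ q, F q ∂π = (∑ m, z.1 m * f (z.2 m) + ∑ n, w.1 n * g (w.2 n)
      - ∫ q, quadCost q.1 q.2 ∂π) / ε := by
    rw [hF, integral_div, integral_sub (hπint fun q => f q.1 + g q.2)
      (hπint fun q => quadCost q.1 q.2), integral_add (hπint fun q => f q.1)
      (hπint fun q => g q.2), hfi, hgi]
  have hcost : (∫⁻ p, ENNReal.ofReal (‖p.1 - p.2‖ ^ 2 / 2) ∂π)
      + ENNReal.ofReal ε * InformationTheory.klDiv π ρ =
      ENNReal.ofReal (∑ m, z.1 m * f (z.2 m) + ∑ n, w.1 n * g (w.2 n)) ∧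
      0 ≤ ∑ m, z.1 m * f (z.2 m) + ∑ n, w.1 n * g (w.2 n) := by
    have hnn := InformationTheory.integral_llr_add_sub_measure_univ_nonneg hac hint
    simp only [probReal_univ, add_sub_cancel_right] at hnn
    have hc0 : 0 ≤ ∫ q, quadCost q.1 q.2 ∂π := integral_nonneg fun q => quadCost_nonneg _ _
    have hval : ∫ q, quadCost q.1 q.2 ∂π + ε * ∫ q, llr π ρ q ∂π =
        ∑ m, z.1 m * f (z.2 m) + ∑ n, w.1 n * g (w.2 n) := by
      rw [integral_congr_ae hllr, hFi]
      field_simp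
      ring
    rw [InformationTheory.klDiv_of_ac_of_integrable hac hint]
    simp only [probReal_univ, add_sub_cancel_right]
    rw [← ENNReal.ofReal_mul hε.le]
    change ∫⁻ p, ENNReal.ofReal (quadCost p.1 p.2) ∂π + _ = _ ∧ _
    rw [← ofReal_integral_eq_lintegral_ofReal (hπint fun q => quadCost q.1 q.2)
      (Eventually.of_forall fun q => quadCost_nonneg _ _), ← hval,
      ENNReal.ofReal_add hc0 (mul_nonneg hε.le hnn)]
    exact ⟨rfl, add_nonneg hc0 (mul_nonneg hε.le hnn)⟩
  rw [entropicOT]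
  refine ENNReal.toReal_le_of_le_ofReal hcost.2 ?_
  rw [← hcost.1]
  exact iInf₂_le π hπ

/-! ### Schrödinger potentials -/

/-- The semi-dual entropic functional in the logarithmic scalings `u`, with the penalty
`(∑ a u)² / 2`, which removes the invariance under constants without moving the minimum. -/
def penalizedSemiDual {M K : ℕ} (a : Fin M → ℝ) (b : Fin K → ℝ) (c : Fin M → Fin K → ℝ)
    (u : Fin M → ℝ) : ℝ :=
  ∑ n, b n * Real.log (∑ m, a m * Real.exp (u m - c m n)) - ∑ m, a m * u m
    + (∑ m, a m * u m) ^ 2 / 2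

lemma weightSpace_nonempty_index {M : ℕ} {a : Fin M → ℝ} {t : ℝ} (ha : a ∈ weightSpace M t) :
    Nonempty (Fin M) := by
  by_contra h
  rw [not_nonempty_iff] at h
  have := ha.2
  simp at this

lemma sum_weight_exp_pos {M : ℕ} {a : Fin M → ℝ} (ha : a ∈ weightSpace M 0) (v : Fin M → ℝ) :
    0 < ∑ m, a m * Real.exp (v m) := by
  have := weightSpace_nonempty_index ha
  exact Finset.sum_pos (fun m _ => mul_pos (ha.1 m) (Real.exp_pos _)) Finset.univ_nonempty

/-- Sublevel sets are bounded: keeping one atom only in the inner sum bounds every `uⱼ` from above,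
the penalty bounds the mean `∑ a u`, and both together bound every `uⱼ` from below. -/
lemma exists_penalizedSemiDual_le {M K : ℕ} {a : Fin M → ℝ} {b : Fin K → ℝ}
    (ha : a ∈ weightSpace M 0) (hb : b ∈ weightSpace K 0) (c : Fin M → Fin K → ℝ) :
    ∃ u, ∀ v, penalizedSemiDual a b c u ≤ penalizedSemiDual a b c v := by
  have hcont : Continuous (penalizedSemiDual a b c) := by
    unfold penalizedSemiDual
    refine ((continuous_finsetSum _ fun n _ => continuous_const.mul
      (Continuous.log (by fun_prop) fun u => ?_)).sub (by fun_prop)).add (by fun_prop)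
    exact (sum_weight_exp_pos ha fun m => u m - c m n).ne'
  refine hcont.exists_forall_le_of_isBounded 0 ?_
  set K₀ := penalizedSemiDual a b c 0
  set C : ℝ := ∑ j, |Real.log (a j) - ∑ n, b n * c j n| with hC
  set R : ℝ := K₀ + C + 1 with hR
  refine (isCompact_Icc (a := fun j => -(2 * R) / a j) (b := fun _ => R)).isBounded.subset ?_
  intro u hu
  set A := ∑ m, a m * u m with hA
  have hlow : ∀ j, u j - C - A + A ^ 2 / 2 ≤ K₀ := by
    intro j
    refine le_trans ?_ (show penalizedSemiDual a b c u ≤ K₀ from hu)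
    unfold penalizedSemiDual
    have h1 : ∀ n, b n * (Real.log (a j) + (u j - c j n)) ≤
        b n * Real.log (∑ m, a m * Real.exp (u m - c m n)) := by
      intro n
      refine mul_le_mul_of_nonneg_left ?_ (hb.1 n).le
      rw [← Real.log_exp (u j - c j n), ← Real.log_mul (ha.1 j).ne' (Real.exp_pos _).ne']
      refine Real.log_le_log (mul_pos (ha.1 j) (Real.exp_pos _)) ?_
      exact Finset.single_le_sum (f := fun m => a m * Real.exp (u m - c m n))
        (fun m _ => (mul_pos (ha.1 m) (Real.exp_pos _)).le) (Finset.mem_univ j)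
    have h2 : ∑ n, b n * (Real.log (a j) + (u j - c j n)) =
        u j + (Real.log (a j) - ∑ n, b n * c j n) := by
      simp only [mul_add, mul_sub, Finset.sum_add_distrib, Finset.sum_sub_distrib,
        ← Finset.sum_mul, hb.2]
      ring
    have h3 : |Real.log (a j) - ∑ n, b n * c j n| ≤ C :=
      Finset.single_le_sum (f := fun j => |Real.log (a j) - ∑ n, b n * c j n|)
        (fun _ _ => abs_nonneg _) (Finset.mem_univ j)
    have h4 := Finset.sum_le_sum fun n (_ : n ∈ Finset.univ) => h1 n
    have h5 := (abs_le.1 h3).1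
    rw [h2] at h4
    linarith
  have hA2 : A ^ 2 / 2 ≤ K₀ + C := by
    have h1 : ∑ j, a j * (u j - C - A + A ^ 2 / 2) ≤ ∑ j, a j * K₀ :=
      Finset.sum_le_sum fun j _ => mul_le_mul_of_nonneg_left (hlow j) (ha.1 j).le
    have h2 : ∑ j, a j * (u j - C - A + A ^ 2 / 2) = A - C - A + A ^ 2 / 2 := by
      simp only [mul_add, mul_sub, Finset.sum_add_distrib, Finset.sum_sub_distrib,
        ← Finset.sum_mul, ha.2, ← hA]
      ring
    rw [h2, ← Finset.sum_mul, ha.2] at h1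
    linarith
  have hR0 : 0 ≤ R := by nlinarith [sq_nonneg A]
  have hAR : |A| ≤ R := by
    apply abs_le_of_sq_le_sq' _ hR0 |> abs_le.2
    nlinarith [sq_nonneg (K₀ + C)]
  have hup : ∀ j, u j ≤ R := fun j => by nlinarith [hlow j, sq_nonneg (A - 1)]
  refine ⟨fun j => ?_, hup⟩
  have h1 : A = a j * u j + ∑ m ∈ Finset.univ.erase j, a m * u m :=
    (Finset.add_sum_erase _ _ (Finset.mem_univ j)).symm
  have h2 : ∑ m ∈ Finset.univ.erase j, a m * u m ≤ R := by
    calc ∑ m ∈ Finset.univ.erase j, a m * u m ≤ ∑ m ∈ Finset.univ.erase j, a m * R :=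
          Finset.sum_le_sum fun m _ => mul_le_mul_of_nonneg_left (hup m) (ha.1 m).le
      _ ≤ ∑ m, a m * R := Finset.sum_le_sum_of_subset_of_nonneg (Finset.erase_subset _ _)
          fun m _ _ => mul_nonneg (ha.1 m).le hR0
      _ = R := by rw [← Finset.sum_mul, ha.2, one_mul]
  rw [div_le_iff₀ (ha.1 j)]
  have := (abs_le.1 hAR).1
  linarith [mul_comm (a j) (u j)]

/-- The Schrödinger system between discrete measures has a solution. The two equations are the
stationarity condition of the semi-dual functional and the definition of `v`. -/
lemma exists_log_scalings {M K : ℕ} {a : Fin M → ℝ} {b : Fin K → ℝ}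
    (ha : a ∈ weightSpace M 0) (hb : b ∈ weightSpace K 0) (c : Fin M → Fin K → ℝ) :
    ∃ (u : Fin M → ℝ) (v : Fin K → ℝ), (∀ m, ∑ n, b n * Real.exp (u m + v n - c m n) = 1) ∧
      ∀ n, ∑ m, a m * Real.exp (u m + v n - c m n) = 1 := by
  obtain ⟨u, hu⟩ := exists_penalizedSemiDual_le ha hb c
  set Z : Fin K → ℝ := fun n => ∑ m, a m * Real.exp (u m - c m n) with hZ
  have hZpos : ∀ n, 0 < Z n := fun n => sum_weight_exp_pos ha fun m => u m - c m n
  set A := ∑ m, a m * u m with hA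
  have hexp : ∀ m n, Real.exp (u m + -Real.log (Z n) - c m n) =
      Real.exp (u m - c m n) / Z n := by
    intro m n
    rw [show u m + -Real.log (Z n) - c m n = u m - c m n - Real.log (Z n) by ring, Real.exp_sub,
      Real.exp_log (hZpos n)]
  have hsnd : ∀ n, ∑ m, a m * (Real.exp (u m - c m n) / Z n) = 1 := by
    intro n
    simp_rw [← mul_div_assoc]
    rw [← Finset.sum_div]
    exact div_self (hZpos n).ne'
  have hstat : ∀ j, ∑ n, b n * (Real.exp (u j - c j n) / Z n) = 1 - A := by
    intro j
    have hlin : ∀ m : Fin M, HasDerivAt (fun t : ℝ => u m + t * (Pi.single j 1 : Fin M → ℝ) m)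
        ((Pi.single j 1 : Fin M → ℝ) m) 0 := fun m => by
      simpa using ((hasDerivAt_id (0 : ℝ)).mul_const _).const_add (u m)
    have hS : HasDerivAt (fun t : ℝ => ∑ m, a m * (u m + t * (Pi.single j 1 : Fin M → ℝ) m))
        (a j) 0 := by
      have := HasDerivAt.fun_sum (u := Finset.univ) fun m _ => (hlin m).const_mul (a m)
      simpa [Pi.single_apply] using this
    have hZd : ∀ n, HasDerivAt
        (fun t : ℝ => ∑ m, a m * Real.exp (u m + t * (Pi.single j 1 : Fin M → ℝ) m - c m n))
        (a j * Real.exp (u j - c j n)) 0 := fun n => by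
      have := HasDerivAt.fun_sum (u := Finset.univ) fun m _ =>
        (((hlin m).sub_const (c m n)).exp).const_mul (a m)
      simpa [Pi.single_apply] using this
    have hD : HasDerivAt (fun t : ℝ => penalizedSemiDual a b c
        fun m => u m + t * (Pi.single j 1 : Fin M → ℝ) m)
        (∑ n, b n * (a j * Real.exp (u j - c j n) / Z n) - a j + A * a j) 0 := by
      unfold penalizedSemiDual
      have h1 := HasDerivAt.fun_sum (u := Finset.univ) fun n _ =>
        ((hZd n).log (by simpa using (hZpos n).ne')).const_mul (b n)
      have h2 := (h1.sub hS).add ((hS.pow 2).div_const 2)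
      convert! h2 using 1
      simp [hZ, hA]
      ring
    have hmin : IsLocalMin (fun t : ℝ => penalizedSemiDual a b c
        fun m => u m + t * (Pi.single j 1 : Fin M → ℝ) m) 0 :=
      Eventually.of_forall fun t => by simpa using hu _
    have h0 := hmin.hasDerivAt_eq_zero hD
    have h1 : ∑ n, b n * (a j * Real.exp (u j - c j n) / Z n) =
        a j * ∑ n, b n * (Real.exp (u j - c j n) / Z n) := by
      rw [Finset.mul_sum]
      exact Finset.sum_congr rfl fun n _ => by ring
    rw [h1] at h0
    have h2 : a j * (∑ n, b n * (Real.exp (u j - c j n) / Z n) - (1 - A)) = 0 := by linarith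
    rcases mul_eq_zero.1 h2 with h | h
    · exact absurd h (ha.1 j).ne'
    · linarith
  have hA0 : A = 0 := by
    have h1 : ∑ j, a j * ∑ n, b n * (Real.exp (u j - c j n) / Z n) = 1 - A := by
      simp_rw [hstat]
      rw [← Finset.sum_mul, ha.2, one_mul]
    have h2 : ∑ j, a j * ∑ n, b n * (Real.exp (u j - c j n) / Z n) = 1 := by
      simp_rw [Finset.mul_sum]
      rw [Finset.sum_comm]
      calc ∑ n, ∑ j, a j * (b n * (Real.exp (u j - c j n) / Z n))
          = ∑ n, b n * ∑ j, a j * (Real.exp (u j - c j n) / Z n) := by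
            refine Finset.sum_congr rfl fun n _ => ?_
            rw [Finset.mul_sum]
            exact Finset.sum_congr rfl fun j _ => by ring
        _ = 1 := by simp_rw [hsnd, mul_one]; exact hb.2
    linarith
  refine ⟨u, fun n => -Real.log (Z n), fun m => ?_, fun n => ?_⟩
  · simp_rw [hexp, hstat, hA0, sub_zero]
  · simp_rw [hexp, hsnd]

/-- The soft minimum `x ↦ -ε log ∑ₙ bₙ exp ((gₙ - c(x, yₙ)) / ε)` that extends a potential from the
atoms of a measure to the whole space. -/
def softMinPotential {d K : ℕ} (ε : ℝ) (w : Particles d K) (g : Fin K → ℝ)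
    (x : EuclideanSpace ℝ (Fin d)) : ℝ :=
  -ε * Real.log (∑ n, w.1 n * Real.exp ((g n - quadCost x (w.2 n)) / ε))

lemma continuous_softMinPotential {d K : ℕ} (ε : ℝ) {w : Particles d K}
    (hw : w.1 ∈ weightSpace K 0) (g : Fin K → ℝ) : Continuous (softMinPotential ε w g) := by
  unfold softMinPotential
  refine continuous_const.mul (Continuous.log ?_ fun x =>
    (sum_weight_exp_pos hw fun n => (g n - quadCost x (w.2 n)) / ε).ne')
  unfold quadCost
  fun_prop

lemma sum_exp_softMinPotential {d K : ℕ} {ε : ℝ} (hε : 0 < ε) {w : Particles d K}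
    (hw : w.1 ∈ weightSpace K 0) (g : Fin K → ℝ) (x : EuclideanSpace ℝ (Fin d)) :
    ∑ n, w.1 n * Real.exp ((softMinPotential ε w g x + g n - quadCost x (w.2 n)) / ε) = 1 := by
  have hpos := sum_weight_exp_pos hw fun n => (g n - quadCost x (w.2 n)) / ε
  set Z := ∑ n, w.1 n * Real.exp ((g n - quadCost x (w.2 n)) / ε) with hZ
  have : ∀ n, Real.exp ((softMinPotential ε w g x + g n - quadCost x (w.2 n)) / ε) =
      Real.exp ((g n - quadCost x (w.2 n)) / ε) / Z := by
    intro n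
    rw [softMinPotential, ← hZ, show (-ε * Real.log Z + g n - quadCost x (w.2 n)) / ε =
      (g n - quadCost x (w.2 n)) / ε - Real.log Z by field_simp; ring, Real.exp_sub,
      Real.exp_log hpos]
  simp_rw [this, ← mul_div_assoc]
  rw [← Finset.sum_div]
  exact div_self hpos.ne'

/-- A potential solving the equation at `x` is the soft minimum there. -/
lemma eq_softMinPotential {d K : ℕ} {ε : ℝ} (hε : 0 < ε) {w : Particles d K}
    (hw : w.1 ∈ weightSpace K 0) {g : Fin K → ℝ} {x : EuclideanSpace ℝ (Fin d)} {t : ℝ}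
    (h : ∑ n, w.1 n * Real.exp ((t + g n - quadCost x (w.2 n)) / ε) = 1) :
    t = softMinPotential ε w g x := by
  have hpos := sum_weight_exp_pos hw fun n => (g n - quadCost x (w.2 n)) / ε
  have : ∀ n, Real.exp ((t + g n - quadCost x (w.2 n)) / ε) =
      Real.exp ((g n - quadCost x (w.2 n)) / ε) * Real.exp (t / ε) := by
    intro n
    rw [← Real.exp_add]
    congr 1
    ring
  simp_rw [this, ← mul_assoc] at h
  rw [← Finset.sum_mul] at h
  have h' := congrArg Real.log h
  rw [Real.log_mul hpos.ne' (Real.exp_pos _).ne', Real.log_exp, Real.log_one] at h'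
  rw [softMinPotential]
  have : t = ε * (t / ε) := by field_simp
  rw [this, show t / ε = -Real.log (∑ n, w.1 n * Real.exp ((g n - quadCost x (w.2 n)) / ε)) by
    linarith]
  ring

/-- Optimal entropic potentials exist, in soft minimum form. -/
lemma exists_potentials {d M K : ℕ} {ε : ℝ} (hε : 0 < ε) {z : Particles d M}
    {w : Particles d K} (hz : z.1 ∈ weightSpace M 0) (hw : w.1 ∈ weightSpace K 0) :
    ∃ (f : Fin M → ℝ) (g : Fin K → ℝ),
      (∀ m, f m = softMinPotential ε w g (z.2 m)) ∧ (∀ n, g n = softMinPotential ε z f (w.2 n)) ∧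
      entropicOT ε (toMeasure z) (toMeasure w) = ∑ m, z.1 m * f m + ∑ n, w.1 n * g n := by
  obtain ⟨u, v, h₁, h₂⟩ := exists_log_scalings hz hw
    (fun m n => quadCost (z.2 m) (w.2 n) / ε)
  have hsc : ∀ m n, u m + v n - quadCost (z.2 m) (w.2 n) / ε =
      (ε * u m + ε * v n - quadCost (z.2 m) (w.2 n)) / ε := by
    intro m n; field_simp
  have hf : ∀ m, ε * u m = softMinPotential ε w (fun n => ε * v n) (z.2 m) := fun m =>
    eq_softMinPotential hε hw (by simp_rw [← hsc]; exact h₁ m)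
  have hg : ∀ n, ε * v n = softMinPotential ε z (fun m => ε * u m) (w.2 n) := fun n =>
    eq_softMinPotential hε hz (by
      rw [← h₂ n]
      refine Finset.sum_congr rfl fun m _ => ?_
      rw [hsc, quadCost_comm, add_comm (ε * v n)])
  refine ⟨fun m => ε * u m, fun n => ε * v n, hf, hg, ?_⟩
  have := entropicOT_eq_dual hε hz hw
    (continuous_softMinPotential ε hw fun n => ε * v n).measurable
    (continuous_softMinPotential ε hz fun m => ε * u m).measurable
    (fun x => by
      simp_rw [← hg]
      exact sum_exp_softMinPotential hε hw _ x)
    (fun y => by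
      simp_rw [← hf]
      rw [← sum_exp_softMinPotential hε hz (fun m => ε * u m) y]
      refine Finset.sum_congr rfl fun m _ => ?_
      rw [quadCost_comm, add_comm (ε * u m)])
  simp_rw [← hf, ← hg] at this
  exact this

/-! ### First variation of the Sinkhorn divergence -/

/-- Increments of the entropic cost in its first argument are dominated by the integral of an
optimal potential at the new point. -/
lemma entropicOT_sub_le {d M M' K : ℕ} {ε : ℝ} (hε : 0 < ε) {z : Particles d M}
    {z' : Particles d M'} {w : Particles d K} (hz : z.1 ∈ weightSpace M 0)
    (hz' : z'.1 ∈ weightSpace M' 0) (hw : w.1 ∈ weightSpace K 0) :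
    ∃ g : Fin K → ℝ,
      entropicOT ε (toMeasure z') (toMeasure w) - entropicOT ε (toMeasure z) (toMeasure w) ≤
        ∑ m, z'.1 m * softMinPotential ε w g (z'.2 m)
          - ∑ m, z.1 m * softMinPotential ε w g (z.2 m) := by
  obtain ⟨f, g, hf, hg, hOT⟩ := exists_potentials hε hz' hw
  refine ⟨g, ?_⟩
  have h := dual_le_entropicOT hε hz hw (continuous_softMinPotential ε hw g).measurable
    (continuous_softMinPotential ε hz' f).measurable (by
      simp_rw [← hg, mul_assoc, ← Finset.mul_sum, sum_exp_softMinPotential hε hw g, mul_one]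
      exact hz.2.le)
  simp_rw [← hg] at h
  simp_rw [hOT, ← hf]
  linarith

lemma entropicOT_comm {d M K : ℕ} {ε : ℝ} (hε : 0 < ε) {z : Particles d M}
    {w : Particles d K} (hz : z.1 ∈ weightSpace M 0) (hw : w.1 ∈ weightSpace K 0) :
    entropicOT ε (toMeasure z) (toMeasure w) = entropicOT ε (toMeasure w) (toMeasure z) := by
  have key : ∀ {M K : ℕ} {z : Particles d M} {w : Particles d K}, z.1 ∈ weightSpace M 0 →
      w.1 ∈ weightSpace K 0 →
      entropicOT ε (toMeasure z) (toMeasure w) ≤ entropicOT ε (toMeasure w) (toMeasure z) := by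
    intro M K z w hz hw
    obtain ⟨f, g, hf, hg, hOT⟩ := exists_potentials hε hz hw
    have h := dual_le_entropicOT hε hw hz (continuous_softMinPotential ε hz f).measurable
      (continuous_softMinPotential ε hw g).measurable (by
        simp_rw [← hf, mul_assoc, ← Finset.mul_sum]
        simp_rw [sum_exp_softMinPotential hε hz f, mul_one]
        exact hw.2.le)
    simp_rw [← hf, ← hg] at h
    linarith
  exact le_antisymm (key hz hw) (key hw hz)

/-- The increment of a soft minimum of quadratic costs is at most that of one of the costs. -/
lemma softMinPotential_sub_le {d K : ℕ} {ε : ℝ} (hε : 0 < ε) {w : Particles d K}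
    (hw : w.1 ∈ weightSpace K 0) (g : Fin K → ℝ) (x x' : EuclideanSpace ℝ (Fin d)) :
    ∃ n, softMinPotential ε w g x' - softMinPotential ε w g x ≤
      ‖x'‖ ^ 2 / 2 - ‖x‖ ^ 2 / 2 - inner ℝ (x' - x) (w.2 n) := by
  have := weightSpace_nonempty_index hw
  obtain ⟨n, hn⟩ := Finite.exists_min fun n => inner ℝ (x' - x) (w.2 n)
  refine ⟨n, ?_⟩
  set κ := ‖x'‖ ^ 2 / 2 - ‖x‖ ^ 2 / 2 - inner ℝ (x' - x) (w.2 n) with hκ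
  have hc : ∀ k, quadCost x' (w.2 k) ≤ quadCost x (w.2 k) + κ := by
    intro k
    unfold quadCost
    have h1 := hn k
    rw [norm_sub_sq_real, norm_sub_sq_real, hκ]
    simp only [inner_sub_left] at h1 ⊢
    linarith
  have hpos := sum_weight_exp_pos hw fun n => (g n - quadCost x (w.2 n)) / ε
  have hle : Real.exp (-κ / ε) * ∑ n, w.1 n * Real.exp ((g n - quadCost x (w.2 n)) / ε) ≤
      ∑ n, w.1 n * Real.exp ((g n - quadCost x' (w.2 n)) / ε) := by
    rw [Finset.mul_sum]
    refine Finset.sum_le_sum fun k _ => ?_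
    rw [mul_left_comm, ← Real.exp_add, ← add_div]
    refine mul_le_mul_of_nonneg_left (Real.exp_le_exp.2 ?_) (hw.1 k).le
    have := hc k
    gcongr
    linarith
  have hlog := Real.log_le_log (mul_pos (Real.exp_pos _) hpos) hle
  rw [Real.log_mul (Real.exp_pos _).ne' hpos.ne', Real.log_exp] at hlog
  have := mul_le_mul_of_nonneg_left hlog hε.le
  rw [mul_add, mul_div_cancel₀ _ hε.ne'] at this
  unfold softMinPotential
  linarith

/-- The Sinkhorn divergence is `diam Ω`-Lipschitz for the Kantorovich-Rubinstein distance: its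
increments are dominated by the integral of a `diam Ω`-Lipschitz function. In the difference of
potentials `f_{μ'ν} - f_{μμ'} / 2 - f_{μμ} / 2` the quadratic terms cancel, and what is left has
differences of (averages of) points of `Ω` as gradients. -/
lemma sinkhornDiv_sub_le {d M K : ℕ} {ε : ℝ} (hε : 0 < ε) {Ω : Set (EuclideanSpace ℝ (Fin d))}
    (hΩ : Bornology.IsBounded Ω) {z z' : Particles d M} {w : Particles d K}
    (hz : z.1 ∈ weightSpace M 0) (hzΩ : ∀ m, z.2 m ∈ Ω)
    (hz' : z'.1 ∈ weightSpace M 0) (hzΩ' : ∀ m, z'.2 m ∈ Ω)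
    (hw : w.1 ∈ weightSpace K 0) (hwΩ : ∀ m, w.2 m ∈ Ω) :
    ∃ h : EuclideanSpace ℝ (Fin d) → ℝ,
      (∀ x x', h x' - h x ≤ Metric.diam Ω * ‖x' - x‖) ∧
      sinkhornDiv ε (toMeasure z') (toMeasure w) - sinkhornDiv ε (toMeasure z) (toMeasure w) ≤
        ∑ m, z'.1 m * h (z'.2 m) - ∑ m, z.1 m * h (z.2 m) := by
  obtain ⟨g₁, h₁⟩ := entropicOT_sub_le hε hz hz' hw
  obtain ⟨g₂, h₂⟩ := entropicOT_sub_le hε hz' hz hz'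
  obtain ⟨g₃, h₃⟩ := entropicOT_sub_le hε hz' hz hz
  refine ⟨fun x => softMinPotential ε w g₁ x - softMinPotential ε z' g₂ x / 2
    - softMinPotential ε z g₃ x / 2, fun x x' => ?_, ?_⟩
  · obtain ⟨n₁, e₁⟩ := softMinPotential_sub_le hε hw g₁ x x'
    obtain ⟨n₂, e₂⟩ := softMinPotential_sub_le hε hz' g₂ x' x
    obtain ⟨n₃, e₃⟩ := softMinPotential_sub_le hε hz g₃ x' x
    have hin : ∀ p ∈ Ω, ∀ q ∈ Ω, inner ℝ (x' - x) p - inner ℝ (x' - x) q ≤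
        Metric.diam Ω * ‖x' - x‖ := by
      intro p hp q hq
      rw [← inner_sub_right, mul_comm]
      refine (real_inner_le_norm _ _).trans (mul_le_mul_of_nonneg_left ?_ (norm_nonneg _))
      rw [← dist_eq_norm]
      exact Metric.dist_le_diam_of_mem hΩ hp hq
    have i₂ := hin _ (hzΩ' n₂) _ (hwΩ n₁)
    have i₃ := hin _ (hzΩ n₃) _ (hwΩ n₁)
    simp only [inner_sub_left] at e₁ e₂ e₃ i₂ i₃
    linarith
  · have hcomm := entropicOT_comm hε hz hz'
    unfold sinkhornDiv
    simp only [mul_sub, Finset.sum_sub_distrib, mul_div_assoc', ← Finset.sum_div]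
    linarith

/-- A transport estimate for moving the particles `z` to `z'`, for `D` the diameter of the domain:
mass is transferred at cost at most `D²` per unit, atoms are displaced at cost at most `D` per unit
of mass and length. -/
def transportBound {d M : ℕ} (D : ℝ) (z z' : Particles d M) : ℝ :=
  D ^ 2 * ∑ m, max (z'.1 m - z.1 m) 0 + D * ∑ m, z'.1 m * ‖z'.2 m - z.2 m‖

lemma sum_lipschitz_sub_le {d M : ℕ} {Ω : Set (EuclideanSpace ℝ (Fin d))}
    (hΩ : Bornology.IsBounded Ω) {z z' : Particles d M}
    (hz : z.1 ∈ weightSpace M 0) (hzΩ : ∀ m, z.2 m ∈ Ω) (hz' : z'.1 ∈ weightSpace M 0)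
    {h : EuclideanSpace ℝ (Fin d) → ℝ} (hh : ∀ x x', h x' - h x ≤ Metric.diam Ω * ‖x' - x‖) :
    ∑ m, z'.1 m * h (z'.2 m) - ∑ m, z.1 m * h (z.2 m) ≤ transportBound (Metric.diam Ω) z z' := by
  have := weightSpace_nonempty_index hz
  -- subtracting the smallest value of `h` is free, since the masses agree
  obtain ⟨n, hn⟩ := Finite.exists_min fun n => h (z.2 n)
  have hsum : ∑ m, z'.1 m * h (z'.2 m) - ∑ m, z.1 m * h (z.2 m) =
      ∑ m, (z'.1 m - z.1 m) * (h (z.2 m) - h (z.2 n))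
        + ∑ m, z'.1 m * (h (z'.2 m) - h (z.2 m)) := by
    simp only [mul_sub, sub_mul, Finset.sum_sub_distrib, ← Finset.sum_mul, hz.2, hz'.2]
    ring
  rw [hsum, transportBound, Finset.mul_sum, Finset.mul_sum]
  refine add_le_add (Finset.sum_le_sum fun m _ => ?_) (Finset.sum_le_sum fun m _ => ?_)
  · have h0 : 0 ≤ h (z.2 m) - h (z.2 n) := sub_nonneg.2 (hn m)
    have h1 : h (z.2 m) - h (z.2 n) ≤ Metric.diam Ω ^ 2 := by
      refine (hh _ _).trans ?_
      rw [sq]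
      refine mul_le_mul_of_nonneg_left ?_ Metric.diam_nonneg
      rw [← dist_eq_norm]
      exact Metric.dist_le_diam_of_mem hΩ (hzΩ m) (hzΩ n)
    calc (z'.1 m - z.1 m) * (h (z.2 m) - h (z.2 n))
        ≤ max (z'.1 m - z.1 m) 0 * (h (z.2 m) - h (z.2 n)) :=
          mul_le_mul_of_nonneg_right (le_max_left _ _) h0
      _ ≤ max (z'.1 m - z.1 m) 0 * Metric.diam Ω ^ 2 :=
          mul_le_mul_of_nonneg_left h1 (le_max_right _ _)
      _ = _ := mul_comm _ _
  · rw [mul_left_comm]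
    exact mul_le_mul_of_nonneg_left (hh _ _) (hz'.1 m).le

lemma abs_sinkhornDiv_sub_le {d M K : ℕ} {ε : ℝ} (hε : 0 < ε)
    {Ω : Set (EuclideanSpace ℝ (Fin d))} (hΩ : Bornology.IsBounded Ω) {z z' : Particles d M}
    {w : Particles d K} (hz : z.1 ∈ weightSpace M 0) (hzΩ : ∀ m, z.2 m ∈ Ω)
    (hz' : z'.1 ∈ weightSpace M 0) (hzΩ' : ∀ m, z'.2 m ∈ Ω)
    (hw : w.1 ∈ weightSpace K 0) (hwΩ : ∀ m, w.2 m ∈ Ω) :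
    |sinkhornDiv ε (toMeasure z') (toMeasure w) - sinkhornDiv ε (toMeasure z) (toMeasure w)| ≤
      transportBound (Metric.diam Ω) z z' := by
  rw [abs_le]
  obtain ⟨h, hh, hle⟩ := sinkhornDiv_sub_le hε hΩ hz hzΩ hz' hzΩ' hw hwΩ
  obtain ⟨k, hk, hle'⟩ := sinkhornDiv_sub_le hε hΩ hz' hzΩ' hz hzΩ hw hwΩ
  have h₁ := sum_lipschitz_sub_le hΩ hz hzΩ hz' hh
  have h₂ := sum_lipschitz_sub_le (h := fun x => -k x) hΩ hz hzΩ hz' fun x x' => by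
    have := hk x' x
    rw [norm_sub_rev] at this
    linarith
  simp only [mul_neg, Finset.sum_neg_distrib] at h₂
  constructor <;> linarith

/-- The log-sum-exp energy is monotone in the divergences and commutes with constants. -/
lemma energy_sub_le {d N : ℕ} {ε β : ℝ} (hβ : 0 < β) [Nonempty (Fin N)]
    {X : Fin N → Measure (EuclideanSpace ℝ (Fin d))}
    {ξ ξ' : Measure (EuclideanSpace ℝ (Fin d))} {t : ℝ}
    (h : ∀ j, sinkhornDiv ε ξ' (X j) - sinkhornDiv ε ξ (X j) ≤ t) :
    energy ε β X ξ' - energy ε β X ξ ≤ t := by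
  have hpos : 0 < ∑ i, Real.exp (-β * sinkhornDiv ε ξ (X i)) :=
    Finset.sum_pos (fun _ _ => Real.exp_pos _) Finset.univ_nonempty
  have hle : Real.exp (-β * t) * ∑ i, Real.exp (-β * sinkhornDiv ε ξ (X i)) ≤
      ∑ i, Real.exp (-β * sinkhornDiv ε ξ' (X i)) := by
    rw [Finset.mul_sum]
    refine Finset.sum_le_sum fun j _ => ?_
    rw [← Real.exp_add]
    refine Real.exp_le_exp.2 ?_
    have := mul_le_mul_of_nonneg_left (h j) hβ.le
    linarith
  have hlog := Real.log_le_log (mul_pos (Real.exp_pos _) hpos) hle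
  rw [Real.log_mul (Real.exp_pos _).ne' hpos.ne', Real.log_exp] at hlog
  have := mul_le_mul_of_nonneg_left hlog (one_div_pos.2 hβ).le
  have hb : 1 / β * (-β * t) = -t := by field_simp
  rw [mul_add, hb] at this
  unfold energy
  linarith

lemma abs_energy_sub_le {d M K N : ℕ} {ε β : ℝ} (hε : 0 < ε) (hβ : 0 < β) [Nonempty (Fin N)]
    {Ω : Set (EuclideanSpace ℝ (Fin d))} (hΩ : Bornology.IsBounded Ω) {z z' : Particles d M}
    {p : Fin N → Particles d K} (hz : z.1 ∈ weightSpace M 0) (hzΩ : ∀ m, z.2 m ∈ Ω)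
    (hz' : z'.1 ∈ weightSpace M 0) (hzΩ' : ∀ m, z'.2 m ∈ Ω)
    (hp : ∀ j, (p j).1 ∈ weightSpace K 0) (hpΩ : ∀ j m, (p j).2 m ∈ Ω) :
    |energy ε β (fun j => toMeasure (p j)) (toMeasure z')
      - energy ε β (fun j => toMeasure (p j)) (toMeasure z)| ≤
      transportBound (Metric.diam Ω) z z' := by
  have h := fun j => abs_le.1 (abs_sinkhornDiv_sub_le hε hΩ hz hzΩ hz' hzΩ' (hp j) (hpΩ j))
  rw [abs_le]
  constructor
  · have := energy_sub_le (ε := ε) hβ (X := fun j => toMeasure (p j)) (ξ := toMeasure z')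
      (ξ' := toMeasure z) (t := transportBound (Metric.diam Ω) z z') fun j => by
        linarith [(h j).1]
    linarith
  · exact energy_sub_le hβ fun j => (h j).2

/-! ### Bounds on the SHK gradient -/

lemma weightSpace_mono {M : ℕ} {s t : ℝ} (h : s ≤ t) : weightSpace M t ⊆ weightSpace M s :=
  fun _ ha => ⟨fun m => h.trans_lt (ha.1 m), ha.2⟩

lemma eventually_add_smul_mem_paramSpace {d M : ℕ} {Ω : Set (EuclideanSpace ℝ (Fin d))}
    (hΩ : IsOpen Ω) {amin Δmin : ℝ} {z w : Particles d M} (hz : z ∈ paramSpace M Ω amin Δmin)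
    (hw : w ∈ tangentSpace d M) :
    ∀ᶠ t : ℝ in 𝓝 0, z + t • w ∈ paramSpace M Ω amin Δmin := by
  obtain ⟨⟨h₁, h₂⟩, h₃, h₄⟩ := hz
  have e₁ : ∀ m, ∀ᶠ t : ℝ in 𝓝 0, amin < z.1 m + t * w.1 m := fun m => by
    have : ContinuousAt (fun t : ℝ => z.1 m + t * w.1 m) 0 := by fun_prop
    exact this.eventually (lt_mem_nhds (by simpa using h₁ m))
  have e₂ : ∀ m, ∀ᶠ t : ℝ in 𝓝 0, z.2 m + t • w.2 m ∈ Ω := fun m => by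
    have : ContinuousAt (fun t : ℝ => z.2 m + t • w.2 m) 0 := by fun_prop
    exact this.eventually (hΩ.mem_nhds (by simpa using h₃ m))
  have e₃ : ∀ m n, m ≠ n → ∀ᶠ t : ℝ in 𝓝 0,
      Δmin < ‖z.2 m + t • w.2 m - (z.2 n + t • w.2 n)‖ := fun m n hmn => by
    have : ContinuousAt (fun t : ℝ => ‖z.2 m + t • w.2 m - (z.2 n + t • w.2 n)‖) 0 := by fun_prop
    exact this.eventually (lt_mem_nhds (by simpa using h₄ m n hmn))
  have e₃' : ∀ᶠ t : ℝ in 𝓝 0, ∀ m n, m ≠ n →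
      Δmin < ‖z.2 m + t • w.2 m - (z.2 n + t • w.2 n)‖ := by
    simp only [eventually_all]
    exact e₃
  filter_upwards [eventually_all.2 e₁, eventually_all.2 e₂, e₃'] with t t₁ t₂ t₃
  refine ⟨⟨t₁, ?_⟩, t₂, t₃⟩
  have hw' : ∑ m, w.1 m = 0 := hw
  simp [Finset.sum_add_distrib, ← Finset.mul_sum, h₂, hw']

/-- Differentials along the parameter space inherit the transport estimate. -/
lemma fderiv_le_of_transportBound {d M : ℕ} {Ω : Set (EuclideanSpace ℝ (Fin d))}
    (hΩ : IsOpen Ω) {amin Δmin D : ℝ} {F : Measure (EuclideanSpace ℝ (Fin d)) → ℝ}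
    {z w : Particles d M} (hz : z ∈ paramSpace M Ω amin Δmin)
    (hF : ∀ z' ∈ paramSpace M Ω amin Δmin,
      F (toMeasure z') - F (toMeasure z) ≤ transportBound D z z')
    {A : Particles d M →L[ℝ] ℝ}
    (hA : HasFDerivWithinAt (fun p : Particles d M => F (toMeasure p)) A
        (paramSpace M Ω amin Δmin) z) (hw : w ∈ tangentSpace d M) :
    A w ≤ D ^ 2 * ∑ m, max (w.1 m) 0 + D * ∑ m, z.1 m * ‖w.2 m‖ := by
  have hev := (eventually_add_smul_mem_paramSpace hΩ hz hw).filter_mono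
    (nhdsWithin_le_nhds (s := Set.Ioi 0))
  have hlim := hA.lim (c := fun t : ℝ => t⁻¹) (d := fun t : ℝ => t • w) (v := w)
    (l := 𝓝[>] (0 : ℝ))
    (by
      have : ContinuousAt (fun t : ℝ => t • w) 0 := by fun_prop
      simpa using this.tendsto.mono_left (nhdsWithin_le_nhds (s := Set.Ioi 0)))
    hev
    (by
      refine tendsto_const_nhds.congr' ?_
      filter_upwards [self_mem_nhdsWithin] with t ht
      rw [smul_smul, inv_mul_cancel₀ (ne_of_gt ht), one_smul])
  have hbd : Tendsto (fun t : ℝ => D ^ 2 * ∑ m, max (w.1 m) 0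
      + D * ∑ m, (z.1 m + t * w.1 m) * ‖w.2 m‖) (𝓝[>] (0 : ℝ))
      (𝓝 (D ^ 2 * ∑ m, max (w.1 m) 0 + D * ∑ m, z.1 m * ‖w.2 m‖)) := by
    have : ContinuousAt (fun t : ℝ => D ^ 2 * ∑ m, max (w.1 m) 0
      + D * ∑ m, (z.1 m + t * w.1 m) * ‖w.2 m‖) 0 := by fun_prop
    have := this.tendsto.mono_left (nhdsWithin_le_nhds (s := Set.Ioi 0))
    simpa using this
  refine le_of_tendsto_of_tendsto hlim hbd ?_
  filter_upwards [hev, self_mem_nhdsWithin] with t ht ht0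
  have ht0 : 0 < t := ht0
  have h1 := hF _ ht
  have h2 : transportBound D z (z + t • w) =
      t * (D ^ 2 * ∑ m, max (w.1 m) 0 + D * ∑ m, (z.1 m + t * w.1 m) * ‖w.2 m‖) := by
    have hmax : ∀ m, max (t * w.1 m) 0 = t * max (w.1 m) 0 := fun m => by
      rw [mul_max_of_nonneg _ _ ht0.le, mul_zero]
    simp only [transportBound, Prod.fst_add, Prod.smul_fst, Pi.add_apply, Pi.smul_apply,
      smul_eq_mul, add_sub_cancel_left, hmax, Prod.snd_add, Prod.smul_snd, norm_smul,
      Real.norm_of_nonneg ht0.le, ← Finset.mul_sum]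
    simp only [mul_left_comm _ t, ← Finset.mul_sum]
    ring
  rw [smul_eq_mul, inv_mul_le_iff₀ ht0, ← h2]
  exact h1

lemma shkGrad_mem_tangentSpace {d M : ℕ} (Ω : Set (EuclideanSpace ℝ (Fin d)))
    (amin Δmin lam : ℝ) (F : Measure (EuclideanSpace ℝ (Fin d)) → ℝ) (z : Particles d M) :
    shkGrad Ω amin Δmin lam F z ∈ tangentSpace d M := by
  unfold shkGrad
  split_ifs with h
  · exact h.choose_spec.1
  · simp [tangentSpace]

/-- The components of the SHK gradient, bounded by testing it against displacements of one atom
and transfers of mass between two atoms. -/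
lemma shkGrad_bounds {d M : ℕ} {Ω : Set (EuclideanSpace ℝ (Fin d))}
    (hΩ : IsOpen Ω) {amin Δmin lam D : ℝ} (hamin : 0 ≤ amin) (hlam : 0 < lam) (hD : 0 ≤ D)
    {F : Measure (EuclideanSpace ℝ (Fin d)) → ℝ}
    {z : Particles d M} (hz : z ∈ paramSpace M Ω amin Δmin)
    (hF : ∀ z' ∈ paramSpace M Ω amin Δmin,
      F (toMeasure z') - F (toMeasure z) ≤ transportBound D z z') (m : Fin M) :
    |(shkGrad Ω amin Δmin lam F z).1 m / z.1 m| ≤ D ^ 2 / lam ^ 2 ∧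
      ‖(shkGrad Ω amin Δmin lam F z).2 m‖ ≤ D := by
  have hapos : ∀ m, 0 < z.1 m := fun m => hamin.trans_lt (hz.1.1 m)
  by_cases h : ∃ v, IsSHKGrad Ω amin Δmin lam F z v
  swap
  -- without a differential `shkGrad` is zero by convention, and the bounds are trivial
  · rw [shkGrad, dif_neg h]
    simp only [Prod.fst_zero, Pi.zero_apply, zero_div, abs_zero, Prod.snd_zero, norm_zero]
    exact ⟨by positivity, hD⟩
  have hv : shkGrad Ω amin Δmin lam F z = h.choose := by rw [shkGrad, dif_pos h]
  obtain ⟨hvt, A, hA, hAw⟩ := h.choose_spec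
  rw [← hv] at hvt hAw
  set v := shkGrad Ω amin Δmin lam F z
  have key : ∀ w ∈ tangentSpace d M,
      shkInner lam z v w ≤ D ^ 2 * ∑ m, max (w.1 m) 0 + D * ∑ m, z.1 m * ‖w.2 m‖ := fun w hw => by
    rw [hAw w hw]
    exact fderiv_le_of_transportBound hΩ hz hF hA hw
  constructor
  · have hdiff : ∀ i j, v.1 i / z.1 i - v.1 j / z.1 j ≤ D ^ 2 / lam ^ 2 := by
      intro i j
      have h1 := key (Pi.single i 1 - Pi.single j 1, 0) (by simp [tangentSpace])
      have h2 : ∑ k, max ((Pi.single i 1 - Pi.single j 1 : Fin M → ℝ) k) 0 ≤ 1 := by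
        calc _ ≤ ∑ k, (Pi.single i 1 : Fin M → ℝ) k := by
              refine Finset.sum_le_sum fun k _ => ?_
              have e₁ : 0 ≤ (Pi.single i 1 : Fin M → ℝ) k := by
                rw [Pi.single_apply]; split_ifs <;> norm_num
              have e₂ : 0 ≤ (Pi.single j 1 : Fin M → ℝ) k := by
                rw [Pi.single_apply]; split_ifs <;> norm_num
              rw [Pi.sub_apply]
              exact max_le (by linarith) e₁
          _ = 1 := by simp
      have h3 : shkInner lam z v (Pi.single i 1 - Pi.single j 1, 0) =
          lam ^ 2 * (v.1 i / z.1 i - v.1 j / z.1 j) := by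
        simp only [shkInner, Pi.zero_apply, inner_zero_right, mul_zero, add_zero, Pi.sub_apply,
          mul_sub, Finset.sum_sub_distrib, Pi.single_apply, mul_ite, mul_one, Finset.sum_ite_eq',
          Finset.mem_univ, if_true]
        ring
      rw [h3] at h1
      simp only [Pi.zero_apply, norm_zero, mul_zero, Finset.sum_const_zero, add_zero] at h1
      rw [le_div_iff₀ (by positivity)]
      nlinarith [sq_nonneg D]
    have hzero : ∑ k, z.1 k * (v.1 k / z.1 k) = 0 := by
      rw [← (show ∑ k, v.1 k = 0 from hvt)]
      exact Finset.sum_congr rfl fun k _ => mul_div_cancel₀ _ (hapos k).ne'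
    have hrep : ∑ k, z.1 k * (v.1 m / z.1 m - v.1 k / z.1 k) = v.1 m / z.1 m := by
      simp only [mul_sub, Finset.sum_sub_distrib, hzero, ← Finset.sum_mul, hz.1.2]
      ring
    have hone : ∑ k, z.1 k * (D ^ 2 / lam ^ 2) = D ^ 2 / lam ^ 2 := by
      rw [← Finset.sum_mul, hz.1.2, one_mul]
    rw [abs_le, ← hrep]
    constructor
    · rw [neg_le, ← Finset.sum_neg_distrib]
      refine le_of_le_of_eq (Finset.sum_le_sum fun k _ => ?_) hone
      rw [← mul_neg, neg_sub]
      exact mul_le_mul_of_nonneg_left (hdiff k m) (hapos k).le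
    · refine le_of_le_of_eq (Finset.sum_le_sum fun k _ => ?_) hone
      exact mul_le_mul_of_nonneg_left (hdiff m k) (hapos k).le
  · have h1 := key (0, Pi.single m (v.2 m)) (by simp [tangentSpace])
    have e1 : ∑ k, z.1 k * inner ℝ (v.2 k) ((Pi.single m (v.2 m) :
        Fin M → EuclideanSpace ℝ (Fin d)) k) = z.1 m * ‖v.2 m‖ ^ 2 := by
      rw [Finset.sum_eq_single m]
      · rw [Pi.single_eq_same, real_inner_self_eq_norm_sq]
      · intro k _ hk
        rw [Pi.single_eq_of_ne hk, inner_zero_right, mul_zero]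
      · simp
    have e2 : ∑ k, z.1 k * ‖(Pi.single m (v.2 m) : Fin M → EuclideanSpace ℝ (Fin d)) k‖ =
        z.1 m * ‖v.2 m‖ := by
      rw [Finset.sum_eq_single m]
      · rw [Pi.single_eq_same]
      · intro k _ hk
        rw [Pi.single_eq_of_ne hk, norm_zero, mul_zero]
      · simp
    simp only [shkInner, Pi.zero_apply, mul_zero, zero_add, max_self, Finset.sum_const_zero] at h1
    rw [e1, e2] at h1
    by_contra hlt
    push Not at hlt
    have hvpos : 0 < ‖v.2 m‖ := hD.trans_lt hlt
    have := mul_pos (hapos m) (mul_pos hvpos (sub_pos.2 hlt))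
    nlinarith

/-! ### Geometry of the basin -/

/-- The entropic self-transport cost is at most `ε` times the entropy of the weights, hence at most
`ε log M`. -/
lemma entropicOT_self_le {d M : ℕ} {ε : ℝ} (hε : 0 < ε) {z : Particles d M}
    (hz : z.1 ∈ weightSpace M 0) :
    entropicOT ε (toMeasure z) (toMeasure z) ≤ ε * Real.log M := by
  have hne := weightSpace_nonempty_index hz
  have hM : (0 : ℝ) < M := by
    have := Fin.pos_iff_nonempty.2 hne
    exact_mod_cast this
  obtain ⟨f, g, hf, -, hOT⟩ := exists_potentials hε hz hz
  rw [hOT, ← Finset.sum_add_distrib]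
  have h1 : ∀ m, f m + g m ≤ -ε * Real.log (z.1 m) := by
    intro m
    have hle : z.1 m * Real.exp (g m / ε) ≤
        ∑ n, z.1 n * Real.exp ((g n - quadCost (z.2 m) (z.2 n)) / ε) := by
      have := Finset.single_le_sum
        (f := fun n => z.1 n * Real.exp ((g n - quadCost (z.2 m) (z.2 n)) / ε))
        (fun n _ => (mul_pos (hz.1 n) (Real.exp_pos _)).le) (Finset.mem_univ m)
      simpa [quadCost] using this
    have hlog := Real.log_le_log (mul_pos (hz.1 m) (Real.exp_pos _)) hle
    rw [Real.log_mul (hz.1 m).ne' (Real.exp_pos _).ne', Real.log_exp] at hlog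
    have := mul_le_mul_of_nonneg_left hlog hε.le
    rw [mul_add, mul_div_cancel₀ _ hε.ne'] at this
    rw [hf m, softMinPotential]
    linarith
  -- the entropy bound, from `log x ≤ x - 1` at `x = 1 / (M aₘ)`
  have h2 : ∀ m, -(z.1 m * Real.log (z.1 m)) ≤ 1 / M - z.1 m + z.1 m * Real.log M := by
    intro m
    have := Real.log_le_sub_one_of_pos (inv_pos.2 (mul_pos hM (hz.1 m)))
    rw [Real.log_inv, Real.log_mul hM.ne' (hz.1 m).ne'] at this
    have h3 := mul_le_mul_of_nonneg_left this (hz.1 m).le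
    have h4 : z.1 m * ((M * z.1 m)⁻¹ - 1) = 1 / M - z.1 m := by
      have := (hz.1 m).ne'
      field_simp
    rw [h4] at h3
    linarith
  calc ∑ m, (z.1 m * f m + z.1 m * g m)
      ≤ ∑ m, ε * (1 / M - z.1 m + z.1 m * Real.log M) := by
        refine Finset.sum_le_sum fun m _ => ?_
        have e1 := mul_le_mul_of_nonneg_left (h1 m) (hz.1 m).le
        have e2 := mul_le_mul_of_nonneg_left (h2 m) hε.le
        linarith
    _ = ε * Real.log M := by
        rw [← Finset.mul_sum]
        simp [Finset.sum_add_distrib, Finset.sum_sub_distrib, ← Finset.sum_mul, hz.2, hM.ne']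

lemma entropicOT_le_sinkhornDiv_add {d M : ℕ} {ε : ℝ} (hε : 0 < ε) {z w : Particles d M}
    (hz : z.1 ∈ weightSpace M 0) (hw : w.1 ∈ weightSpace M 0) :
    entropicOT ε (toMeasure z) (toMeasure w) ≤
      sinkhornDiv ε (toMeasure z) (toMeasure w) + ε * Real.log M := by
  have h1 := entropicOT_self_le hε hz
  have h2 := entropicOT_self_le hε hw
  unfold sinkhornDiv
  linarith

/-- If all atoms of `z` are at distance at least `δ` from an atom of `w`, then its mass costs at
least `δ² / 2` per unit. -/
lemma mass_mul_le_entropicOT {d M K : ℕ} {ε : ℝ} (hε : 0 < ε) {z : Particles d M}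
    {w : Particles d K} (hz : z.1 ∈ weightSpace M 0) (hw : w.1 ∈ weightSpace K 0) {δ : ℝ}
    (hδ : 0 ≤ δ) {n : Fin K} (hn : ∀ m, δ ≤ ‖z.2 m - w.2 n‖) :
    w.1 n * (δ ^ 2 / 2) ≤ entropicOT ε (toMeasure z) (toMeasure w) := by
  classical
  have hg0 : ∀ y, 0 ≤ (if y = w.2 n then δ ^ 2 / 2 else 0) := fun y => by
    split_ifs <;> positivity
  -- the potential `g` is `δ² / 2` at that atom and zero elsewhere
  have h := dual_le_entropicOT hε hz hw (f := fun _ => 0)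
    (g := fun y => if y = w.2 n then δ ^ 2 / 2 else 0) measurable_const
    (Measurable.ite (measurableSet_singleton _) measurable_const measurable_const) (by
      calc _ ≤ ∑ m, ∑ k, z.1 m * w.1 k * 1 := by
            refine Finset.sum_le_sum fun m _ => Finset.sum_le_sum fun k _ =>
              mul_le_mul_of_nonneg_left ?_ (mul_pos (hz.1 m) (hw.1 k)).le
            refine Real.exp_le_one_iff.2 (div_nonpos_of_nonpos_of_nonneg ?_ hε.le)
            split_ifs with hk
            · rw [hk, quadCost]
              have := pow_le_pow_left₀ hδ (hn m) 2
              linarith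
            · linarith [quadCost_nonneg (z.2 m) (w.2 k)]
        _ = 1 := by simp [← Finset.mul_sum, hz.2, hw.2])
  simp only [mul_zero, Finset.sum_const_zero, zero_add] at h
  refine le_trans ?_ h
  have := Finset.single_le_sum
    (f := fun k => w.1 k * (if w.2 k = w.2 n then δ ^ 2 / 2 else 0))
    (fun k _ => mul_nonneg (hw.1 k).le (hg0 _)) (Finset.mem_univ n)
  simpa using this

/-- If all atoms of `z` but one are at distance at least `s` from an atom of `w`, then the missing
mass costs at least `s² / 2` per unit. -/
lemma mass_defect_mul_le_entropicOT {d M K : ℕ} {ε : ℝ} (hε : 0 < ε) {z : Particles d M}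
    {w : Particles d K} (hz : z.1 ∈ weightSpace M 0) (hw : w.1 ∈ weightSpace K 0) {s : ℝ}
    (hs : 0 ≤ s) {n : Fin K} {k : Fin M} (hk : ∀ m, m ≠ k → s ≤ ‖z.2 m - w.2 n‖)
    (hinj : Function.Injective z.2) :
    (w.1 n - z.1 k) * (s ^ 2 / 2) ≤ entropicOT ε (toMeasure z) (toMeasure w) := by
  classical
  have hg0 : ∀ y, 0 ≤ (if y = w.2 n then s ^ 2 / 2 else 0) := fun y => by
    split_ifs <;> positivity
  have hs2 : 0 ≤ s ^ 2 / 2 := by positivity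
  -- `f` and `g` are `-s² / 2` and `s² / 2` at the two atoms and zero elsewhere
  have h := dual_le_entropicOT hε hz hw (f := fun x => if x = z.2 k then -(s ^ 2 / 2) else 0)
    (g := fun y => if y = w.2 n then s ^ 2 / 2 else 0)
    (Measurable.ite (measurableSet_singleton _) measurable_const measurable_const)
    (Measurable.ite (measurableSet_singleton _) measurable_const measurable_const) (by
      calc _ ≤ ∑ m, ∑ k, z.1 m * w.1 k * 1 := by
            refine Finset.sum_le_sum fun m _ => Finset.sum_le_sum fun j _ =>
              mul_le_mul_of_nonneg_left ?_ (mul_pos (hz.1 m) (hw.1 j)).le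
            refine Real.exp_le_one_iff.2 (div_nonpos_of_nonpos_of_nonneg ?_ hε.le)
            have hc := quadCost_nonneg (z.2 m) (w.2 j)
            split_ifs with h₁ h₂ h₂
            · linarith
            · linarith
            · have hmk : m ≠ k := fun h => h₁ (by rw [h])
              rw [h₂, quadCost]
              have := pow_le_pow_left₀ hs (hk m hmk) 2
              linarith
            · linarith
        _ = 1 := by simp [← Finset.mul_sum, hz.2, hw.2])
  refine le_trans ?_ h
  have h₁ := Finset.single_le_sum
    (f := fun k => w.1 k * (if w.2 k = w.2 n then s ^ 2 / 2 else 0))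
    (fun k _ => mul_nonneg (hw.1 k).le (hg0 _)) (Finset.mem_univ n)
  have h₂ : ∑ m, z.1 m * (if z.2 m = z.2 k then -(s ^ 2 / 2) else 0) = z.1 k * -(s ^ 2 / 2) := by
    simp [hinj.eq_iff]
  rw [h₂]
  simp only [if_true] at h₁
  linarith

lemma sep_le {d M : ℕ} (x : Fin M → EuclideanSpace ℝ (Fin d)) {m n : Fin M} (h : m ≠ n) :
    sep x ≤ ‖x m - x n‖ :=
  ciInf_le (f := fun q : {q : Fin M × Fin M // q.1 ≠ q.2} => ‖x q.1.1 - x q.1.2‖)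
    (Set.finite_range _).bddBelow ⟨(m, n), h⟩

lemma le_sep {d M : ℕ} (hM : 2 ≤ M) {x : Fin M → EuclideanSpace ℝ (Fin d)} {t : ℝ}
    (h : ∀ m n, m ≠ n → t ≤ ‖x m - x n‖) : t ≤ sep x := by
  have : Nonempty {p : Fin M × Fin M // p.1 ≠ p.2} :=
    ⟨⟨(⟨0, by omega⟩, ⟨1, by omega⟩), by simp⟩⟩
  exact le_ciInf fun p => h _ _ p.2

lemma distBoundary_le {d M : ℕ} (Ω : Set (EuclideanSpace ℝ (Fin d)))
    (x : Fin M → EuclideanSpace ℝ (Fin d)) (m : Fin M) :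
    distBoundary Ω x ≤ Metric.infDist (x m) (frontier Ω) :=
  ciInf_le (Set.finite_range _).bddBelow m

/-- Near a pattern with atoms `y`, the atoms of a point of the basin are matched with those of the
pattern up to distance `δ`, and the weights cannot drop by `τ`. Hence the margins of the pattern,
reduced accordingly, are margins of the point. -/
lemma basin_margins {d M : ℕ} (hM : 2 ≤ M) {Ω : Set (EuclideanSpace ℝ (Fin d))}
    {amin Δmin ε δ τ r : ℝ} (hamin : 0 < amin) (hΔ : 0 < Δmin) (hε : 0 < ε)
    {p z : Particles d M} (hp : p ∈ paramSpace M Ω amin Δmin)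
    (hz : z ∈ paramSpace M Ω amin Δmin) (hδ : 0 < δ) (hδ' : δ < (sep p.2 - Δmin) / 2)
    (hr : r < rLoc M amin ε (sep p.2) δ τ)
    (hzr : sinkhornDiv ε (toMeasure z) (toMeasure p) ≤ r) :
    (∀ m, (⨅ k, p.1 k) - τ / 2 ≤ z.1 m) ∧ distBoundary Ω p.2 - δ ≤ distBoundary Ω z.2 ∧
      sep p.2 - 2 * δ ≤ sep z.2 := by
  have hz0 := weightSpace_mono hamin.le hz.1
  have hp0 := weightSpace_mono hamin.le hp.1
  have hne := weightSpace_nonempty_index hp0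
  have hOT := entropicOT_le_sinkhornDiv_add hε hz0 hp0
  rw [rLoc, lt_min_iff] at hr
  have hnear : ∀ n, ∃ m, ‖z.2 m - p.2 n‖ < δ := by
    intro n
    by_contra! hcon
    have h1 := mass_mul_le_entropicOT hε hz0 hp0 hδ.le hcon
    have h2 : amin * (δ ^ 2 / 2) < p.1 n * (δ ^ 2 / 2) :=
      mul_lt_mul_of_pos_right (hp.1.1 n) (by positivity)
    linarith [hr.1]
  choose σ hσ using hnear
  have hσinj : Function.Injective σ := by
    intro n n' h
    by_contra hnn
    have h1 := sep_le p.2 hnn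
    have h2 : ‖p.2 n - p.2 n'‖ ≤ ‖z.2 (σ n) - p.2 n‖ + ‖z.2 (σ n') - p.2 n'‖ := by
      rw [← norm_neg (z.2 (σ n) - p.2 n), h]
      refine (norm_add_le _ _).trans_eq' ?_
      congr 1
      abel
    linarith [hσ n, hσ n']
  have hσsurj : Function.Surjective σ := Finite.surjective_of_injective hσinj
  have hzinj : Function.Injective z.2 := by
    intro m n h
    by_contra hmn
    have := hz.2.2 m n hmn
    rw [h, sub_self, norm_zero] at this
    linarith
  refine ⟨fun m => ?_, ?_, ?_⟩
  · obtain ⟨n, rfl⟩ := hσsurj m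
    have hsδ : 0 < sep p.2 - δ := by linarith
    have h1 := mass_defect_mul_le_entropicOT hε hz0 hp0 hsδ.le (n := n) (k := σ n) (fun m hm => by
      obtain ⟨n', rfl⟩ := hσsurj m
      have hnn : n' ≠ n := fun h => hm (by rw [h])
      have h1 := sep_le p.2 hnn
      have h2 : ‖p.2 n' - p.2 n‖ ≤ ‖z.2 (σ n') - p.2 n'‖ + ‖z.2 (σ n') - p.2 n‖ := by
        rw [← norm_neg (z.2 (σ n') - p.2 n')]
        refine (norm_add_le _ _).trans_eq' ?_
        congr 1
        abel
      linarith [hσ n']) hzinj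
    have h2 : (⨅ k, p.1 k) ≤ p.1 n := ciInf_le (Set.finite_range _).bddBelow n
    have h3 : (p.1 n - z.1 (σ n)) * ((sep p.2 - δ) ^ 2 / 2) ≤
        τ / 2 * ((sep p.2 - δ) ^ 2 / 2) := by
      linarith [hr.2]
    have h4 := le_of_mul_le_mul_right h3 (by positivity)
    linarith
  · refine le_ciInf fun m => ?_
    obtain ⟨n, rfl⟩ := hσsurj m
    have h1 := distBoundary_le Ω p.2 n
    have h2 := Metric.infDist_le_infDist_add_dist (s := frontier Ω) (x := p.2 n) (y := z.2 (σ n))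
    rw [dist_comm, dist_eq_norm] at h2
    linarith [hσ n]
  · refine le_sep hM fun m m' hmm => ?_
    obtain ⟨n, rfl⟩ := hσsurj m
    obtain ⟨n', rfl⟩ := hσsurj m'
    have hnn : n ≠ n' := fun h => hmm (by rw [h])
    have h1 := sep_le p.2 hnn
    have h2 : ‖p.2 n - p.2 n'‖ ≤ ‖z.2 (σ n) - z.2 (σ n')‖ + ‖z.2 (σ n) - p.2 n‖
        + ‖z.2 (σ n') - p.2 n'‖ := by
      rw [← norm_neg (z.2 (σ n) - p.2 n)]
      refine norm_add₃_le.trans_eq' ?_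
      congr 1
      abel
    linarith [hσ n, hσ n']

/-! ### The retraction -/

lemma ball_infDist_frontier_subset {d : ℕ} {Ω : Set (EuclideanSpace ℝ (Fin d))} (hΩ : IsOpen Ω)
    {x : EuclideanSpace ℝ (Fin d)} (hx : x ∈ Ω) :
    Metric.ball x (Metric.infDist x (frontier Ω)) ⊆ Ω := by
  rcases le_or_gt (Metric.infDist x (frontier Ω)) 0 with h | h
  · rw [Metric.ball_eq_empty.2 h]; exact Set.empty_subset _
  refine IsPreconnected.subset_left_of_subset_union hΩ isClosed_closure.isOpen_compl
    (Set.disjoint_compl_right_iff_subset.2 subset_closure) (fun y hy => ?_)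
    ⟨x, Metric.mem_ball_self h, hx⟩ (convex_ball x _).isPreconnected
  by_contra hcon
  simp only [Set.mem_union, Set.mem_compl_iff, not_or, not_not] at hcon
  have hyf : y ∈ frontier Ω := by rw [hΩ.frontier_eq]; exact ⟨hcon.2, hcon.1⟩
  have := Metric.infDist_le_dist_of_mem (x := x) hyf
  rw [Metric.mem_ball, dist_comm] at hy
  linarith

lemma iInf_log_le {d M : ℕ} (z : Particles d M) (amin : ℝ) (m : Fin M) :
    ⨅ k, Real.log (z.1 k / amin) ≤ Real.log (z.1 m / amin) :=
  ciInf_le (Set.finite_range _).bddBelow m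

lemma retraction_mem_paramSpace {d M : ℕ} {Ω : Set (EuclideanSpace ℝ (Fin d))} (hΩ : IsOpen Ω)
    {amin Δmin : ℝ} (hamin : 0 < amin) {z w : Particles d M}
    (hz : z ∈ paramSpace M Ω amin Δmin) (hw : w ∈ retractionDomain Ω amin Δmin z) :
    retraction z w ∈ paramSpace M Ω amin Δmin := by
  have hz0 := weightSpace_mono hamin.le hz.1
  obtain ⟨-, h₁, h₂⟩ := hw
  have hZ := sum_weight_exp_pos hz0 fun j => w.1 j / z.1 j
  refine ⟨⟨fun m => ?_, ?_⟩, fun m => ?_, fun m n hmn => ?_⟩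
  · set c := 1 / 2 * ⨅ k, Real.log (z.1 k / amin) with hc
    have hle : ∑ j, z.1 j * Real.exp (w.1 j / z.1 j) ≤ Real.exp c := by
      calc _ ≤ ∑ j, z.1 j * Real.exp c := Finset.sum_le_sum fun j _ =>
            mul_le_mul_of_nonneg_left (Real.exp_le_exp.2 (abs_lt.1 (h₁ j)).2.le) (hz0.1 j).le
        _ = Real.exp c := by rw [← Finset.sum_mul, hz0.2, one_mul]
    have hlog : 2 * c ≤ Real.log (z.1 m / amin) := by
      have := iInf_log_le z amin m
      linarith
    have h3 : Real.exp (2 * c) ≤ z.1 m / amin := by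
      rw [← Real.exp_log (div_pos (hz0.1 m) hamin)]
      exact Real.exp_le_exp.2 hlog
    have h4 : amin * Real.exp c ≤ z.1 m * Real.exp (-c) := by
      rw [le_div_iff₀ hamin] at h3
      calc amin * Real.exp c = Real.exp (2 * c) * amin * Real.exp (-c) := by
            rw [mul_comm (Real.exp (2 * c)), mul_assoc, ← Real.exp_add]
            congr 2
            ring
        _ ≤ _ := mul_le_mul_of_nonneg_right h3 (Real.exp_pos _).le
    have h5 : z.1 m * Real.exp (-c) < z.1 m * Real.exp (w.1 m / z.1 m) :=
      mul_lt_mul_of_pos_left (Real.exp_lt_exp.2 (abs_lt.1 (h₁ m)).1) (hz0.1 m)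
    change amin < z.1 m * Real.exp (w.1 m / z.1 m) / _
    rw [lt_div_iff₀ hZ]
    have := mul_le_mul_of_nonneg_left hle hamin.le
    linarith
  · simp only [retraction]
    rw [← Finset.sum_div]
    exact div_self hZ.ne'
  · refine ball_infDist_frontier_subset hΩ (hz.2.1 m) ?_
    have h3 := distBoundary_le Ω z.2 m
    have h4 := h₂ m
    have h5 := min_le_left (distBoundary Ω z.2) (sep z.2 - Δmin)
    have h6 := norm_nonneg (w.2 m)
    rw [Metric.mem_ball, dist_eq_norm, retraction, add_sub_cancel_left]
    linarith
  · have h3 := sep_le z.2 hmn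
    have h4 := h₂ m
    have h4' := h₂ n
    have h5 := min_le_right (distBoundary Ω z.2) (sep z.2 - Δmin)
    have h6 : ‖z.2 m - z.2 n‖ ≤ ‖z.2 m + w.2 m - (z.2 n + w.2 n)‖ + ‖w.2 m‖ + ‖w.2 n‖ := by
      rw [← norm_neg (w.2 m)]
      refine norm_add₃_le.trans_eq' ?_
      congr 1
      abel
    change Δmin < ‖z.2 m + w.2 m - (z.2 n + w.2 n)‖
    linarith

/-- Steps of size `t < etaRet` along a vector with the bounds of the gradient stay in the domain of
the retraction, at points that have the margins of the basin. -/
lemma neg_smul_mem_retractionDomain {d M : ℕ} {Ω : Set (EuclideanSpace ℝ (Fin d))}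
    {amin Δmin lam δ τ t : ℝ} (hamin : 0 < amin) (hlam : 0 < lam) (ht : 0 ≤ t)
    (hD : 0 < Metric.diam Ω) {p z v : Particles d M} (hτ : amin < (⨅ k, p.1 k) - τ)
    (hz : z.1 ∈ weightSpace M 0)
    (ht' : t < etaRet Ω amin Δmin lam δ τ p)
    (hz₁ : ∀ m, (⨅ k, p.1 k) - τ ≤ z.1 m)
    (hz₂ : distBoundary Ω p.2 - δ ≤ distBoundary Ω z.2) (hz₃ : sep p.2 - 2 * δ ≤ sep z.2)
    (hv : v ∈ tangentSpace d M)
    (hv₁ : ∀ m, |v.1 m / z.1 m| ≤ Metric.diam Ω ^ 2 / lam ^ 2)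
    (hv₂ : ∀ m, ‖v.2 m‖ ≤ Metric.diam Ω) :
    -(t • v) ∈ retractionDomain Ω amin Δmin z := by
  have hne := weightSpace_nonempty_index hz
  rw [etaRet, lt_min_iff] at ht'
  have hv' : ∑ m, v.1 m = 0 := hv
  set D := Metric.diam Ω
  refine ⟨?_, fun m => ?_, fun m => ?_⟩
  · simp [tangentSpace, ← Finset.mul_sum, hv']
  · have h1 : |(-(t • v)).1 m / z.1 m| ≤ t * (D ^ 2 / lam ^ 2) := by
      have : (-(t • v)).1 m / z.1 m = -(t * (v.1 m / z.1 m)) := by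
        simp only [Prod.fst_neg, Prod.smul_fst, Pi.neg_apply, Pi.smul_apply, smul_eq_mul]
        ring
      rw [this, abs_neg, abs_mul, abs_of_nonneg ht]
      exact mul_le_mul_of_nonneg_left (hv₁ m) ht
    have h2 : Real.log (((⨅ k, p.1 k) - τ) / amin) ≤ ⨅ k, Real.log (z.1 k / amin) := by
      refine le_ciInf fun k => Real.log_le_log (div_pos (hamin.trans hτ) hamin) ?_
      exact div_le_div_of_nonneg_right (hz₁ k) hamin.le
    have h3 := mul_lt_mul_of_pos_right ht'.1 (show 0 < D ^ 2 / lam ^ 2 by positivity)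
    have h4 : lam ^ 2 / (2 * D ^ 2) * Real.log (((⨅ k, p.1 k) - τ) / amin) * (D ^ 2 / lam ^ 2) =
        1 / 2 * Real.log (((⨅ k, p.1 k) - τ) / amin) := by
      field_simp
    linarith
  · have h1 : ‖(-(t • v)).2 m‖ ≤ t * D := by
      simp only [Prod.snd_neg, Prod.smul_snd, Pi.neg_apply, Pi.smul_apply, norm_neg, norm_smul,
        Real.norm_of_nonneg ht]
      exact mul_le_mul_of_nonneg_left (hv₂ m) ht
    have h2 : min (distBoundary Ω p.2 - δ) (sep p.2 - 2 * δ - Δmin) ≤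
        min (distBoundary Ω z.2) (sep z.2 - Δmin) :=
      min_le_min hz₂ (by linarith)
    have h3 := mul_lt_mul_of_pos_right ht'.2 hD
    have h4 : 1 / (2 * D) * min (distBoundary Ω p.2 - δ) (sep p.2 - 2 * δ - Δmin) * D =
        1 / 2 * min (distBoundary Ω p.2 - δ) (sep p.2 - 2 * δ - Δmin) := by
      field_simp
    linarith

lemma one_le_retraction_normalizer {d M : ℕ} {z w : Particles d M} (hz : z.1 ∈ weightSpace M 0)
    (hw : w ∈ tangentSpace d M) : 1 ≤ ∑ j, z.1 j * Real.exp (w.1 j / z.1 j) := by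
  calc (1 : ℝ) = ∑ j, z.1 j * (w.1 j / z.1 j + 1) := by
        have : ∀ j, z.1 j * (w.1 j / z.1 j + 1) = w.1 j + z.1 j := fun j => by
          rw [mul_add, mul_div_cancel₀ _ (hz.1 j).ne', mul_one]
        simp_rw [this, Finset.sum_add_distrib, hz.2]
        rw [show ∑ j, w.1 j = 0 from hw, zero_add]
    _ ≤ _ := Finset.sum_le_sum fun j _ =>
        mul_le_mul_of_nonneg_left (Real.add_one_le_exp _) (hz.1 j).le

lemma shkInner_self {d M : ℕ} {lam : ℝ} {z : Particles d M} (hz : z.1 ∈ weightSpace M 0)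
    (w : Particles d M) :
    shkInner lam z w w =
      lam ^ 2 * ∑ m, z.1 m * |w.1 m / z.1 m| ^ 2 + ∑ m, z.1 m * ‖w.2 m‖ ^ 2 := by
  rw [shkInner, Finset.sum_add_distrib, Finset.mul_sum]
  congr 1
  · refine Finset.sum_congr rfl fun m _ => ?_
    rw [sq_abs]
    have := (hz.1 m).ne'
    field_simp
  · simp_rw [real_inner_self_eq_norm_sq]

lemma shkInner_self_nonneg {d M : ℕ} {lam : ℝ} {z : Particles d M} (hz : z.1 ∈ weightSpace M 0)
    (w : Particles d M) : 0 ≤ shkInner lam z w w := by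
  rw [shkInner_self hz]
  have := fun m => (hz.1 m).le
  exact add_nonneg (mul_nonneg (sq_nonneg _) (Finset.sum_nonneg fun m _ =>
    mul_nonneg (this m) (sq_nonneg _))) (Finset.sum_nonneg fun m _ =>
    mul_nonneg (this m) (sq_nonneg _))

lemma shkNorm_neg_smul {d M : ℕ} (lam : ℝ) (z v : Particles d M) {t : ℝ} (ht : 0 ≤ t) :
    shkNorm lam z (-(t • v)) = t * shkNorm lam z v := by
  have : shkInner lam z (-(t • v)) (-(t • v)) = t ^ 2 * shkInner lam z v v := by
    rw [shkInner, shkInner, Finset.mul_sum]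
    refine Finset.sum_congr rfl fun m _ => ?_
    simp only [Prod.fst_neg, Prod.smul_fst, Pi.neg_apply, Pi.smul_apply, smul_eq_mul, Prod.snd_neg,
      Prod.smul_snd, inner_neg_neg, real_inner_smul_left, real_inner_smul_right]
    ring
  rw [shkNorm, this, Real.sqrt_mul (sq_nonneg t), Real.sqrt_sq ht, shkNorm]

/-- The transport estimate of a retraction step, if the weights grow at most by the factor `S²`.
The transferred mass `∑ (a' - a)⁺` is at most `∑ a' |δa / a|`, because the normalizing sum is at
least one, and Jensen's inequality for the weights `a'` brings in the SHK norm. -/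
lemma transportBound_retraction_le {d M : ℕ} {D lam S : ℝ} (hD : 0 ≤ D) (hlam : 0 < lam)
    (hS : 0 ≤ S) {z w : Particles d M} (hz : z.1 ∈ weightSpace M 0) (hw : w ∈ tangentSpace d M)
    (hz' : (retraction z w).1 ∈ weightSpace M 0)
    (hgrow : ∀ m, (retraction z w).1 m ≤ S ^ 2 * z.1 m) :
    transportBound D z (retraction z w) ≤ gradBound D lam * S * shkNorm lam z w := by
  set a := (retraction z w).1 with ha
  set P := ∑ m, a m * |w.1 m / z.1 m| with hP
  set Q := ∑ m, a m * ‖w.2 m‖ with hQ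
  have hZ := one_le_retraction_normalizer hz hw
  have hmass : ∑ m, max (a m - z.1 m) 0 ≤ P := by
    refine Finset.sum_le_sum fun m _ => max_le ?_ (mul_nonneg (hz'.1 m).le (abs_nonneg _))
    have h1 : z.1 m = a m * ((∑ j, z.1 j * Real.exp (w.1 j / z.1 j)) *
        Real.exp (-(w.1 m / z.1 m))) := by
      rw [ha, retraction, Real.exp_neg]
      have := (Real.exp_pos (w.1 m / z.1 m)).ne'
      have := (zero_lt_one.trans_le hZ).ne'
      field_simp
    have h2 : 1 * Real.exp (-(w.1 m / z.1 m)) ≤ (∑ j, z.1 j * Real.exp (w.1 j / z.1 j)) *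
        Real.exp (-(w.1 m / z.1 m)) := mul_le_mul_of_nonneg_right hZ (Real.exp_pos _).le
    have h3 := Real.add_one_le_exp (-(w.1 m / z.1 m))
    have h4 := le_abs_self (w.1 m / z.1 m)
    have h5 : a m * (1 - |w.1 m / z.1 m|) ≤ z.1 m := by
      conv_rhs => rw [h1]
      exact mul_le_mul_of_nonneg_left (by linarith) (hz'.1 m).le
    linarith
  have hjensen : ∀ u : Fin M → ℝ, (∀ m, 0 ≤ u m) →
      (∑ m, a m * u m) ^ 2 ≤ S ^ 2 * ∑ m, z.1 m * u m ^ 2 := by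
    intro u hu
    refine (Real.pow_arith_mean_le_arith_mean_pow Finset.univ a u (fun m _ => (hz'.1 m).le) hz'.2
      (fun m _ => hu m) 2).trans ?_
    rw [Finset.mul_sum]
    refine Finset.sum_le_sum fun m _ => ?_
    rw [← mul_assoc]
    exact mul_le_mul_of_nonneg_right (hgrow m) (sq_nonneg _)
  have hP2 := hjensen (fun m => |w.1 m / z.1 m|) fun m => abs_nonneg _
  have hQ2 := hjensen (fun m => ‖w.2 m‖) fun m => norm_nonneg _
  have hbound : transportBound D z (retraction z w) ≤ D * (D * P + Q) := by
    have h1 : transportBound D z (retraction z w) =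
        D ^ 2 * ∑ m, max (a m - z.1 m) 0 + D * Q := by
      rw [transportBound, hQ]
      simp [retraction, ha]
    rw [h1]
    have := mul_le_mul_of_nonneg_left hmass (sq_nonneg D)
    linarith
  refine hbound.trans ?_
  rw [gradBound, mul_assoc D, mul_assoc D]
  refine mul_le_mul_of_nonneg_left ?_ hD
  rw [shkNorm, shkInner_self hz, mul_assoc, ← Real.sqrt_sq hS, ← Real.sqrt_mul (sq_nonneg S),
    ← Real.sqrt_mul (by positivity)]
  refine Real.le_sqrt_of_sq_le ?_
  -- Cauchy-Schwarz for `(D / lam, 1)` and `(lam * P, Q)`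
  have hcs : (D * P + Q) ^ 2 ≤ (1 + D ^ 2 / lam ^ 2) * (lam ^ 2 * P ^ 2 + Q ^ 2) := by
    have : (1 + D ^ 2 / lam ^ 2) * (lam ^ 2 * P ^ 2 + Q ^ 2) =
        (D * P + Q) ^ 2 + (lam * P - D / lam * Q) ^ 2 := by
      field_simp
      ring
    rw [this]
    linarith [sq_nonneg (lam * P - D / lam * Q)]
  refine hcs.trans (mul_le_mul_of_nonneg_left ?_ (by positivity))
  have := mul_le_mul_of_nonneg_left hP2 (sq_nonneg lam)
  linarith

lemma stepFactor_nonneg (D lam amin η : ℝ) : 0 ≤ stepFactor D lam amin η :=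
  le_min (Real.exp_pos _).le (by positivity)

/-- Growth of the weights in a retraction step with relative increments at most `η D² / lam²`. -/
lemma retraction_weight_le {d M : ℕ} {D lam amin η : ℝ} (hlam : 0 < lam)
    (hamin : 0 < amin) (hη : 0 ≤ η) {z w : Particles d M} (hz : z.1 ∈ weightSpace M amin)
    (hw : w ∈ tangentSpace d M) (hz' : (retraction z w).1 ∈ weightSpace M 0)
    (hw' : ∀ m, |w.1 m / z.1 m| ≤ η * D ^ 2 / lam ^ 2) (m : Fin M) :
    (retraction z w).1 m ≤ stepFactor D lam amin η ^ 2 * z.1 m := by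
  have hz0 := weightSpace_mono hamin.le hz
  have hZ := one_le_retraction_normalizer hz0 hw
  have hq : 0 ≤ η * D ^ 2 / lam ^ 2 := by positivity
  rcases min_choice (Real.exp (η * D ^ 2 / lam ^ 2)) (1 / Real.sqrt amin) with h | h
  · rw [stepFactor, h]
    have h1 : (retraction z w).1 m ≤ z.1 m * Real.exp (w.1 m / z.1 m) :=
      div_le_self (mul_pos (hz0.1 m) (Real.exp_pos _)).le hZ
    refine h1.trans ?_
    rw [mul_comm, ← Real.exp_nat_mul]
    refine mul_le_mul_of_nonneg_right (Real.exp_le_exp.2 ?_) (hz0.1 m).le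
    have := (le_abs_self _).trans (hw' m)
    push_cast
    linarith
  · rw [stepFactor, h, div_pow, Real.sq_sqrt hamin.le, one_pow]
    have h1 : (retraction z w).1 m ≤ 1 := by
      rw [← hz'.2]
      exact Finset.single_le_sum (fun k _ => (hz'.1 k).le) (Finset.mem_univ m)
    refine h1.trans ?_
    rw [one_div, ← div_eq_inv_mul, one_le_div hamin]
    exact (hz.1 m).le

lemma continuous_retraction {d M : ℕ} {z : Particles d M} (hz : z.1 ∈ weightSpace M 0) :
    Continuous (retraction z) := by
  unfold retraction
  refine Continuous.prodMk (continuous_pi fun m => ?_) (by fun_prop)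
  refine Continuous.div (by fun_prop) (by fun_prop) fun w => ?_
  exact (sum_weight_exp_pos hz fun j => w.1 j / z.1 j).ne'

/-! ### Convergence of particles -/

lemma tendsto_transportBound {d M : ℕ} (D : ℝ) {ι : Type*} {l : Filter ι}
    {z : ι → Particles d M} {z' : Particles d M} (h : Tendsto z l (𝓝 z')) :
    Tendsto (fun k => transportBound D z' (z k)) l (𝓝 0) := by
  have hc : Continuous fun y : Particles d M => transportBound D z' y := by
    unfold transportBound
    fun_prop
  have := (hc.tendsto z').comp h
  simpa [transportBound, Function.comp_def] using this

/-- A quantity controlled by the transport estimate is continuous along the parameter space. -/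
lemma tendsto_of_transportBound {d M : ℕ} {D : ℝ} {ι : Type*} {l : Filter ι}
    {F : Measure (EuclideanSpace ℝ (Fin d)) → ℝ} {z : ι → Particles d M} {z' : Particles d M}
    (hF : ∀ k, |F (toMeasure (z k)) - F (toMeasure z')| ≤ transportBound D z' (z k))
    (h : Tendsto z l (𝓝 z')) : Tendsto (fun k => F (toMeasure (z k))) l (𝓝 (F (toMeasure z'))) :=
  tendsto_iff_norm_sub_tendsto_zero.2
    (squeeze_zero (fun _ => norm_nonneg _) hF (tendsto_transportBound D h))

/-- The transport estimate controls the distance of particles, as the weights are bounded below.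
The transferred mass `∑ (a' - a)⁺` equals `∑ (a - a')⁺`, so it bounds every `|a'ₘ - aₘ|`. -/
lemma dist_le_transportBound {d M : ℕ} {D amin : ℝ} (hD : 0 < D) (hamin : 0 < amin)
    {z z' : Particles d M} (hz : z.1 ∈ weightSpace M amin) (hz' : z'.1 ∈ weightSpace M amin) :
    dist z z' ≤ (1 / D ^ 2 + 1 / (D * amin)) * transportBound D z z' := by
  set P := ∑ m, max (z'.1 m - z.1 m) 0 with hP
  set Q := ∑ m, z'.1 m * ‖z'.2 m - z.2 m‖ with hQ
  have hP0 : 0 ≤ P := Finset.sum_nonneg fun m _ => le_max_right _ _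
  have hQ0 : 0 ≤ Q := Finset.sum_nonneg fun m _ =>
    mul_nonneg (hamin.trans (hz'.1 m)).le (norm_nonneg _)
  have hT : transportBound D z z' = D ^ 2 * P + D * Q := rfl
  have hPneg : ∑ m, max (z.1 m - z'.1 m) 0 = P := by
    have : ∀ m, max (z.1 m - z'.1 m) 0 = max (z'.1 m - z.1 m) 0 + (z.1 m - z'.1 m) := fun m => by
      rcases le_total (z.1 m) (z'.1 m) with h | h
      · rw [max_eq_right (by linarith), max_eq_left (by linarith)]; ring
      · rw [max_eq_left (by linarith), max_eq_right (by linarith)]; ring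
    simp_rw [this, Finset.sum_add_distrib, Finset.sum_sub_distrib, hz.2, hz'.2]
    simp [hP]
  have h1 : ∀ m, dist (z.1 m) (z'.1 m) ≤ P := by
    intro m
    rw [Real.dist_eq, abs_le]
    have e1 := Finset.single_le_sum (f := fun m => max (z'.1 m - z.1 m) 0)
      (fun m _ => le_max_right _ _) (Finset.mem_univ m)
    have e2 := Finset.single_le_sum (f := fun m => max (z.1 m - z'.1 m) 0)
      (fun m _ => le_max_right _ _) (Finset.mem_univ m)
    rw [hPneg] at e2
    have e3 := le_max_left (z'.1 m - z.1 m) 0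
    have e4 := le_max_left (z.1 m - z'.1 m) 0
    constructor <;> linarith
  have h2 : ∀ m, dist (z.2 m) (z'.2 m) ≤ Q / amin := by
    intro m
    rw [dist_comm, dist_eq_norm, le_div_iff₀ hamin, mul_comm]
    refine (mul_le_mul_of_nonneg_right (hz'.1 m).le (norm_nonneg _)).trans ?_
    exact Finset.single_le_sum (f := fun m => z'.1 m * ‖z'.2 m - z.2 m‖)
      (fun m _ => mul_nonneg (hamin.trans (hz'.1 m)).le (norm_nonneg _)) (Finset.mem_univ m)
  have hsum : (1 / D ^ 2 + 1 / (D * amin)) * transportBound D z z' =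
      P + Q / amin + (Q / D + D * P / amin) := by
    rw [hT]
    field_simp
    ring
  have hrest : 0 ≤ Q / D + D * P / amin := by positivity
  have hQa : 0 ≤ Q / amin := by positivity
  rw [hsum, Prod.dist_eq]
  refine max_le ?_ ?_
  · exact (dist_pi_le_iff (by positivity)).2 fun m => (h1 m).trans (by linarith)
  · exact (dist_pi_le_iff (by positivity)).2 fun m => (h2 m).trans (by linarith)

/-- Limits of particles with uniform margins stay in the parameter space. -/
lemma mem_paramSpace_of_tendsto {d M : ℕ} {Ω : Set (EuclideanSpace ℝ (Fin d))} (hΩ : IsOpen Ω)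
    {amin Δmin a₀ d₀ s₀ : ℝ} (ha₀ : amin < a₀) (hd₀ : 0 < d₀) (hs₀ : Δmin < s₀)
    {z : ℕ → Particles d M} {z' : Particles d M} (h : Tendsto z atTop (𝓝 z'))
    (hz : ∀ k, z k ∈ paramSpace M Ω amin Δmin) (h₁ : ∀ k m, a₀ ≤ (z k).1 m)
    (h₂ : ∀ k, d₀ ≤ distBoundary Ω (z k).2) (h₃ : ∀ k, s₀ ≤ sep (z k).2) :
    z' ∈ paramSpace M Ω amin Δmin := by
  have hw : ∀ m, Tendsto (fun k => (z k).1 m) atTop (𝓝 (z'.1 m)) := fun m =>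
    ((continuous_apply m).comp continuous_fst).tendsto z' |>.comp h
  have hx : ∀ m, Tendsto (fun k => (z k).2 m) atTop (𝓝 (z'.2 m)) := fun m =>
    ((continuous_apply m).comp continuous_snd).tendsto z' |>.comp h
  refine ⟨⟨fun m => ?_, ?_⟩, fun m => ?_, fun m n hmn => ?_⟩
  · exact ha₀.trans_le (ge_of_tendsto' (hw m) fun k => h₁ k m)
  · refine tendsto_nhds_unique (tendsto_finsetSum _ fun m _ => hw m) ?_
    simp_rw [fun k => (hz k).1.2]
    exact tendsto_const_nhds
  · obtain ⟨k, hk⟩ := ((tendsto_iff_dist_tendsto_zero.1 (hx m)).eventually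
      (gt_mem_nhds hd₀)).exists
    refine ball_infDist_frontier_subset hΩ ((hz k).2.1 m) ?_
    rw [Metric.mem_ball, dist_comm]
    exact hk.trans_le ((h₂ k).trans (distBoundary_le Ω _ m))
  · refine hs₀.trans_le (ge_of_tendsto' ((hx m).sub (hx n)).norm fun k => ?_)
    exact (h₃ k).trans (sep_le _ hmn)

/-- The discrete measure `toMeasure z` as a probability measure on a set `Ω` that contains its
atoms. -/
def toProbabilityMeasure {d M : ℕ} {Ω : Set (EuclideanSpace ℝ (Fin d))} (z : Particles d M)
    (hz : z.1 ∈ weightSpace M 0) (hΩ : ∀ m, z.2 m ∈ Ω) : ProbabilityMeasure Ω :=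
  ⟨∑ m, ENNReal.ofReal (z.1 m) • Measure.dirac (⟨z.2 m, hΩ m⟩ : Ω), ⟨by
    simp only [Measure.finsetSum_apply, Measure.smul_apply, measure_univ, smul_eq_mul, mul_one]
    rw [← ENNReal.ofReal_sum_of_nonneg (fun m _ => (hz.1 m).le), hz.2, ENNReal.ofReal_one]⟩⟩

lemma map_toProbabilityMeasure {d M : ℕ} {Ω : Set (EuclideanSpace ℝ (Fin d))} (z : Particles d M)
    (hz : z.1 ∈ weightSpace M 0) (hΩ : ∀ m, z.2 m ∈ Ω) :
    (toProbabilityMeasure z hz hΩ : Measure Ω).map Subtype.val = toMeasure z := by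
  change Measure.map Subtype.val
    (∑ m, ENNReal.ofReal (z.1 m) • Measure.dirac (⟨z.2 m, hΩ m⟩ : Ω)) = _
  rw [Measure.map_finset_sum measurable_subtype_coe.aemeasurable, toMeasure]
  refine Finset.sum_congr rfl fun m _ => ?_
  rw [Measure.map_smul, Measure.map_dirac' measurable_subtype_coe]

lemma integral_toProbabilityMeasure {d M : ℕ} {Ω : Set (EuclideanSpace ℝ (Fin d))}
    (z : Particles d M) (hz : z.1 ∈ weightSpace M 0) (hΩ : ∀ m, z.2 m ∈ Ω) (f : Ω → ℝ) :
    ∫ x, f x ∂(toProbabilityMeasure z hz hΩ : Measure Ω) = ∑ m, z.1 m * f ⟨z.2 m, hΩ m⟩ := by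
  change ∫ x, f x ∂(∑ m, ENNReal.ofReal (z.1 m) • Measure.dirac (⟨z.2 m, hΩ m⟩ : Ω)) = _
  rw [integral_finsetSum_measure
    (fun m _ => (integrable_dirac enorm_lt_top).smul_measure ENNReal.ofReal_ne_top)]
  refine Finset.sum_congr rfl fun m _ => ?_
  rw [integral_smul_measure, integral_dirac, ENNReal.toReal_ofReal (hz.1 m).le, smul_eq_mul]

lemma weaklyConvergesIn_of_tendsto {d M : ℕ} {Ω : Set (EuclideanSpace ℝ (Fin d))}
    {z : ℕ → Particles d M} {z' : Particles d M} (h : Tendsto z atTop (𝓝 z'))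
    (hz : ∀ k, (z k).1 ∈ weightSpace M 0) (hzΩ : ∀ k m, (z k).2 m ∈ Ω)
    (hz' : z'.1 ∈ weightSpace M 0) (hzΩ' : ∀ m, z'.2 m ∈ Ω) :
    WeaklyConvergesIn Ω (fun k => toMeasure (z k)) (toMeasure z') := by
  refine ⟨fun k => toProbabilityMeasure (z k) (hz k) (hzΩ k), toProbabilityMeasure z' hz' hzΩ',
    fun k => map_toProbabilityMeasure _ _ _, map_toProbabilityMeasure _ _ _, ?_⟩
  rw [ProbabilityMeasure.tendsto_iff_forall_integral_tendsto]
  intro f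
  simp_rw [integral_toProbabilityMeasure]
  refine tendsto_finsetSum _ fun m _ => ?_
  have hw : Tendsto (fun k => (z k).1 m) atTop (𝓝 (z'.1 m)) :=
    ((continuous_apply m).comp continuous_fst).tendsto z' |>.comp h
  have hx : Tendsto (fun k => (z k).2 m) atTop (𝓝 (z'.2 m)) :=
    ((continuous_apply m).comp continuous_snd).tendsto z' |>.comp h
  refine hw.mul ((f.continuous.tendsto _).comp ?_)
  exact tendsto_subtype_rng.2 hx

/-! ### Iteration complexity -/

lemma gradBound_pos {D lam : ℝ} (hD : 0 < D) : 0 < gradBound D lam := by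
  unfold gradBound; positivity

/-- The logarithm of the step factor in the form in which it enters the complexity bound. -/
lemma two_mul_log_stepFactor {D lam amin η : ℝ} (hamin : 0 < amin) :
    2 * Real.log (stepFactor D lam amin η) =
      min (2 * η * D ^ 2 / lam ^ 2) (-Real.log amin) := by
  have h1 : Real.log (stepFactor D lam amin η) =
      min (η * D ^ 2 / lam ^ 2) (-(Real.log amin / 2)) := by
    have hs : 1 / Real.sqrt amin = Real.exp (-(Real.log amin / 2)) := by
      rw [Real.exp_neg, ← Real.log_sqrt hamin.le, Real.exp_log (Real.sqrt_pos.2 hamin), one_div]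
    rw [stepFactor, hs, ← Real.exp_monotone.map_min, Real.log_exp]
  rw [h1, mul_min_of_nonneg _ _ (by norm_num : (0 : ℝ) ≤ 2)]
  congr 1 <;> ring

/-- The complexity bounds are the logarithm of the geometric bound; the second one uses
`-log (1 - x) ≥ x` and `1 - √(1 - x) ≥ x / 2`. -/
lemma iterationComplexity_of_geometricBound {d : ℕ} {ε D lam amin μ η gap : ℝ}
    (hD : 0 < D) (hamin : 0 < amin) (hμ : 0 < μ) (hη : 0 < η) (hμη : μ * η < 1)
    (hgap : 0 ≤ gap) {ξ : ℕ → Measure (EuclideanSpace ℝ (Fin d))}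
    {Xs : Measure (EuclideanSpace ℝ (Fin d))}
    (h : GeometricBound ε D lam amin μ η gap ξ Xs) :
    IterationComplexity ε D lam amin μ η gap ξ Xs := by
  intro acc hacc k
  have hk := h k
  rw [← Real.sqrt_eq_rpow] at hk
  rcases hgap.eq_or_lt with hg | hg
  · rw [← hg, mul_zero, Real.sqrt_zero, mul_zero, zero_div, zero_mul] at hk
    exact ⟨fun _ => hk.trans hacc.le, fun _ => hk.trans hacc.le⟩
  have hG : 0 < gradBound D lam := gradBound_pos hD
  have hS : 0 < stepFactor D lam amin η :=
    lt_min (Real.exp_pos _) (one_div_pos.2 (Real.sqrt_pos.2 hamin))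
  have hx : 0 < μ * η := mul_pos hμ hη
  have hq0 : 0 < 1 - μ * η := by linarith
  have hs1 : Real.sqrt (1 - μ * η) < 1 := by
    rw [Real.sqrt_lt' one_pos]
    linarith
  have hs2 : μ * η / 2 ≤ 1 - Real.sqrt (1 - μ * η) := by
    have : Real.sqrt (1 - μ * η) ≤ 1 - μ * η / 2 := by
      rw [Real.sqrt_le_left (by linarith)]
      nlinarith [sq_nonneg (μ * η)]
    linarith
  have hden : 0 < 1 - Real.sqrt (1 - μ * η) := by linarith
  have hgη : 0 < 2 * η * gap := by positivity
  have hlog : Real.log (1 - μ * η) ≤ -(μ * η) := by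
    have := Real.log_le_sub_one_of_pos hq0
    linarith
  have hmin := two_mul_log_stepFactor (D := D) (lam := lam) (η := η) hamin
  -- the logarithmic form of `bound ≤ acc`
  have hreduce : min (2 * η * D ^ 2 / lam ^ 2) (-Real.log amin)
      + 2 * Real.log (gradBound D lam) + Real.log (2 * η * gap)
      - 2 * Real.log (acc * (1 - Real.sqrt (1 - μ * η))) + k * Real.log (1 - μ * η) ≤ 0 →
      sinkhornDiv ε (ξ k) Xs ≤ acc := by
    intro hle
    refine hk.trans ?_
    rw [mul_comm η μ, div_mul_eq_mul_div, div_le_iff₀ hden]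
    have hpow : 0 < (1 - μ * η) ^ ((k : ℝ) / 2) := Real.rpow_pos_of_pos hq0 _
    rw [← Real.log_le_log_iff (by positivity) (by positivity), Real.log_mul (by positivity)
      hpow.ne', Real.log_mul (by positivity) (by positivity), Real.log_mul hG.ne' hS.ne',
      Real.log_sqrt hgη.le, Real.log_rpow hq0]
    linarith
  constructor
  · intro hle
    refine hreduce ?_
    rw [div_le_iff₀ (by linarith), one_div, Real.log_inv] at hle
    linarith
  · intro hle
    refine hreduce ?_
    have h1 : min (2 * η * D ^ 2 / lam ^ 2) (-Real.log amin) =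
        μ * η * min (2 * D ^ 2 / (μ * lam ^ 2)) (-(Real.log amin / (μ * η))) := by
      rw [mul_min_of_nonneg _ _ hx.le]
      congr 1
      · field_simp
      · field_simp
    have h2 := mul_le_mul_of_nonneg_left hle hx.le
    have h3 : μ * η * (min (2 * D ^ 2 / (μ * lam ^ 2)) (-(Real.log amin / (μ * η)))
        + 1 / (μ * η) * Real.log (2 * η * gap)
        + 2 / (μ * η) * Real.log (2 * gradBound D lam / (acc * μ * η))) =
        min (2 * η * D ^ 2 / lam ^ 2) (-Real.log amin) + Real.log (2 * η * gap)
        + 2 * Real.log (2 * gradBound D lam / (acc * μ * η)) := by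
      rw [h1]
      field_simp
    rw [h3] at h2
    have h4 : Real.log (2 * gradBound D lam / (acc * μ * η)) =
        Real.log (gradBound D lam) - Real.log (acc * (μ * η / 2)) := by
      rw [← Real.log_div hG.ne' (by positivity)]
      congr 1
      field_simp
    have h5 : Real.log (acc * (μ * η / 2)) ≤
        Real.log (acc * (1 - Real.sqrt (1 - μ * η))) :=
      Real.log_le_log (by positivity) (mul_le_mul_of_nonneg_left hs2 hacc.le)
    have h6 := mul_le_mul_of_nonneg_left hlog (Nat.cast_nonneg (α := ℝ) k)
    rw [h4] at h2
    linarith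

/-! ### Descent -/

lemma retraction_zero {d M : ℕ} {z : Particles d M} (hz : z.1 ∈ weightSpace M 0) :
    retraction z 0 = z := by
  simp [retraction, hz.2]

/-- Smoothness gives a decrease by `t / 2 * ‖grad‖²` for steps `t ≤ 1 / L`. -/
lemma energy_retraction_le {d M : ℕ} {Ω : Set (EuclideanSpace ℝ (Fin d))} {amin Δmin lam L t : ℝ}
    {F : Measure (EuclideanSpace ℝ (Fin d)) → ℝ} {B : Set (Measure (EuclideanSpace ℝ (Fin d)))}
    (hamin : 0 ≤ amin) (hL : 0 < L) (hsmooth : RetractionSmoothOn M Ω amin Δmin lam F B L)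
    {z : Particles d M} (hz : z ∈ paramSpace M Ω amin Δmin) (hzB : toMeasure z ∈ B)
    (ht : 0 < t) (htL : t ≤ 1 / L)
    (hdom : -(t • shkGrad Ω amin Δmin lam F z) ∈ retractionDomain Ω amin Δmin z) :
    F (toMeasure (retraction z (-(t • shkGrad Ω amin Δmin lam F z)))) ≤
      F (toMeasure z) - t / 2 * shkNorm lam z (shkGrad Ω amin Δmin lam F z) ^ 2 := by
  set v := shkGrad Ω amin Δmin lam F z with hv
  have hvt : ∑ m, v.1 m = 0 := shkGrad_mem_tangentSpace Ω amin Δmin lam F z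
  have h := hsmooth z hz hzB (-v) (by simp [tangentSpace, hvt]) t ht (by rwa [smul_neg])
  have hnn := shkInner_self_nonneg (lam := lam) (weightSpace_mono hamin hz.1) v
  have hn : shkNorm lam z v ^ 2 = shkInner lam z v v := Real.sq_sqrt hnn
  have h1 : shkNorm lam z (-v) = shkNorm lam z v := by
    have := shkNorm_neg_smul lam z v zero_le_one
    rwa [one_smul, one_mul] at this
  have h2 : shkInner lam z v (-v) = -shkInner lam z v v := by
    simp only [shkInner, Prod.fst_neg, Prod.snd_neg, Pi.neg_apply, inner_neg_right,
      ← Finset.sum_neg_distrib]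
    exact Finset.sum_congr rfl fun m _ => by ring
  rw [smul_neg, ← hv, h1, h2, hn] at h
  rw [hn]
  rw [le_div_iff₀ hL] at htL
  have h3 := mul_nonneg (mul_nonneg ht.le hnn) (sub_nonneg.2 htL)
  nlinarith

/-- A continuous function that stays off the level `r` cannot cross it. -/
lemma le_of_continuousOn_of_ne {φ : ℝ → ℝ} {η r : ℝ} (hη : 0 ≤ η)
    (hφ : ContinuousOn φ (Set.Icc 0 η)) (h0 : φ 0 ≤ r)
    (h : ∀ t ∈ Set.Icc 0 η, φ t ≠ r) : φ η ≤ r := by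
  by_contra! hcon
  obtain ⟨t, ht, htr⟩ := intermediate_value_Icc hη hφ ⟨h0, hcon.le⟩
  exact h t ht htr

lemma rpow_natCast_div_two {x : ℝ} (hx : 0 ≤ x) (k : ℕ) :
    x ^ ((k : ℝ) / 2) = Real.sqrt x ^ k := by
  rw [Real.sqrt_eq_rpow, ← Real.rpow_natCast, ← Real.rpow_mul hx]
  congr 1
  ring

/-- A convergent sequence with geometrically small increments exceeds its limit by at most the
geometric tail: `uₖ - C qᵏ / (1 - q)` is monotone. -/
lemma le_add_geometric_of_increment_bound {u : ℕ → ℝ} {C q l : ℝ} (hq0 : 0 ≤ q) (hq1 : q < 1)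
    (hu : ∀ k, |u (k + 1) - u k| ≤ C * q ^ k) (hl : Tendsto u atTop (𝓝 l)) (k : ℕ) :
    u k ≤ l + C / (1 - q) * q ^ k := by
  have h1 : 0 < 1 - q := by linarith
  have hmono : Monotone fun k => u k - C / (1 - q) * q ^ k := by
    refine monotone_nat_of_le_succ fun k => ?_
    have := (abs_le.1 (hu k)).1
    have e : C / (1 - q) * q ^ k - C / (1 - q) * q ^ (k + 1) = C * q ^ k := by
      rw [pow_succ]
      field_simp
    linarith
  have hlim : Tendsto (fun k => u k - C / (1 - q) * q ^ k) atTop (𝓝 (l - C / (1 - q) * 0)) :=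
    hl.sub ((tendsto_pow_atTop_nhds_zero_of_lt_one hq0 hq1).const_mul _)
  have := hmono.ge_of_tendsto hlim k
  linarith

end

theorem theorem2 (d M N : ℕ) (hM : 2 ≤ M)
    (Ω : Set (EuclideanSpace ℝ (Fin d))) (hΩ_open : IsOpen Ω)
    (hΩ_bdd : Bornology.IsBounded Ω) (hΩ_conv : Convex ℝ Ω)
    (amin Δmin ε β lam : ℝ) (ha_min : 0 < amin) (ha_min' : amin < 1 / M) (hΔ_min : 0 < Δmin)
    (hε : 0 < ε) (hβ : 0 < β) (hlam : 0 < lam)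
    -- the stored patterns, with parameters `(b_j, y_j)`
    (p : Fin N → Particles d M) (hp : ∀ j, p j ∈ paramSpace M Ω amin Δmin)
    (X : Fin N → Measure (EuclideanSpace ℝ (Fin d))) (hX : ∀ j, X j = toMeasure (p j))
    -- the energy, the basin of the `i`-th pattern, and their constants
    (E : Measure (EuclideanSpace ℝ (Fin d)) → ℝ) (hE : E = energy ε β X)
    (i : Fin N) (δ τ r : ℝ)
    (hδ : 0 < δ) (hδ' : δ < min (distBoundary Ω (p i).2) ((sep (p i).2 - Δmin) / 2))
    (hτ : 0 < τ) (hτ' : τ < weightMargin amin (p i).1)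
    (hr : 0 < r) (hr' : r < rLoc M amin ε (sep (p i).2) δ τ)
    (B : ℝ → Set (Measure (EuclideanSpace ℝ (Fin d))))
    (hB : ∀ s, B s = basin M Ω amin Δmin ε (X i) s)
    (Estar : ℝ) (hEstar : Estar = sInf (E '' B r))
    (D : ℝ) (hD : D = Metric.diam Ω)
    -- local smoothness, unique minimizer, PL inequality
    (L : ℝ) (hL : 0 < L) (hsmooth : RetractionSmoothOn M Ω amin Δmin lam E (B r) L)
    (Xs : Measure (EuclideanSpace ℝ (Fin d))) (hXs : IsUniqueMinOn E (B r) Xs)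
    (μ : ℝ) (hμ : 0 < μ) (hPL : PLOn M Ω amin Δmin lam E (B r) μ)
    -- the step size
    (η : ℝ) (hη : 0 < η)
    (hη' : η < min (min (1 / L) (1 / μ)) (etaRet Ω amin Δmin lam δ τ (p i))) :
    -- the retraction step is well defined at every point of the basin
    (∀ z ∈ paramSpace M Ω amin Δmin, toMeasure z ∈ B r →
      -(η • shkGrad Ω amin Δmin lam E z) ∈ retractionDomain Ω amin Δmin z) ∧
    -- the iterates, as ordered particles `z k` and as measures `ξ k`
    ∀ (z : ℕ → Particles d M) (ξ : ℕ → Measure (EuclideanSpace ℝ (Fin d))),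
      z 0 ∈ paramSpace M Ω amin Δmin →
      (∀ k, z (k + 1) = shkStep Ω amin Δmin lam E η (z k)) →
      (∀ k, ξ k = toMeasure (z k)) →
      ((∀ k, ξ k ∈ B r) →
        GeometricBound ε D lam amin μ η (E (ξ 0) - Estar) ξ Xs ∧
        WeaklyConvergesIn Ω ξ Xs ∧
        IterationComplexity ε D lam amin μ η (E (ξ 0) - Estar) ξ Xs) ∧
      (∀ α : ℝ, α = alphaRatio D lam amin μ r (E (ξ 0) - Estar) →
        1 < α →
        4 * α / (μ * (α + 1) ^ 2) ≤ η →
        ξ 0 ∈ B (r - rhoRadius D lam amin μ η (E (ξ 0) - Estar)) →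
        (∀ k, ξ k ∈ B r) ∧
        GeometricBound ε D lam amin μ η (E (ξ 0) - Estar) ξ Xs ∧
        WeaklyConvergesIn Ω ξ Xs ∧
        IterationComplexity ε D lam amin μ η (E (ξ 0) - Estar) ξ Xs) := by
  have hXeq : X = fun j => toMeasure (p j) := funext hX
  have hNe : Nonempty (Fin N) := ⟨i⟩
  -- constants
  obtain ⟨hδ₁, hδ₂⟩ := lt_min_iff.1 hδ'
  obtain ⟨hημ', hηret⟩ := lt_min_iff.1 hη'
  obtain ⟨hηL, hημ⟩ := lt_min_iff.1 hημ'
  have hμη : μ * η < 1 := by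
    rw [lt_div_iff₀ hμ] at hημ
    linarith
  have hMne : Nonempty (Fin M) := ⟨⟨0, by omega⟩⟩
  have hτ₂ : amin < (⨅ k, (p i).1 k) - τ := by
    have h1 : weightMargin amin (p i).1 + amin ≤ ⨅ k, (p i).1 k := le_ciInf fun m => by
      have : weightMargin amin (p i).1 ≤ (p i).1 m - amin :=
        ciInf_le (Set.finite_range _).bddBelow m
      linarith
    linarith
  have hw0 : ∀ {z : Particles d M}, z ∈ paramSpace M Ω amin Δmin → z.1 ∈ weightSpace M 0 :=
    fun hz => weightSpace_mono ha_min.le hz.1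
  have hDpos : 0 < D := by
    have h1 := (hp i).2.2 ⟨0, by omega⟩ ⟨1, by omega⟩ (by simp)
    have h2 := Metric.dist_le_diam_of_mem hΩ_bdd ((hp i).2.1 ⟨0, by omega⟩)
      ((hp i).2.1 ⟨1, by omega⟩)
    rw [dist_eq_norm] at h2
    linarith
  have hG : 0 < gradBound D lam := gradBound_pos hDpos
  set q := Real.sqrt (1 - μ * η) with hq
  have hq2 : q ^ 2 = 1 - μ * η := Real.sq_sqrt (by linarith)
  have hq0 : 0 < q := Real.sqrt_pos.2 (by linarith)
  have hq1 : q < 1 := by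
    rw [hq, Real.sqrt_lt' one_pos]
    linarith [mul_pos hμ hη]
  -- membership in the basin, and the minimal energy
  have hBmem : ∀ {z : Particles d M} {s : ℝ}, z ∈ paramSpace M Ω amin Δmin →
      (toMeasure z ∈ B s ↔ sinkhornDiv ε (toMeasure z) (toMeasure (p i)) ≤ s) := by
    intro z s hz
    rw [hB, hX]
    exact ⟨fun h => h.2, fun h => ⟨⟨z, hz, rfl⟩, h⟩⟩
  have hEmin : Estar = E Xs := by
    rw [hEstar]
    refine IsLeast.csInf_eq ⟨⟨Xs, hXs.1, rfl⟩, ?_⟩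
    rintro _ ⟨ξ, hξ, rfl⟩
    exact hXs.2.1 hξ
  have hEle : ∀ ξ ∈ B r, Estar ≤ E ξ := fun ξ hξ => hEmin ▸ hXs.2.1 hξ
  -- Lipschitz estimates
  have hElip : ∀ z ∈ paramSpace M Ω amin Δmin, ∀ z' ∈ paramSpace M Ω amin Δmin,
      |E (toMeasure z') - E (toMeasure z)| ≤ transportBound D z z' := by
    intro z hz z' hz'
    rw [hE, hXeq, hD]
    exact abs_energy_sub_le hε hβ hΩ_bdd (hw0 hz) hz.2.1 (hw0 hz') hz'.2.1
      (fun j => hw0 (hp j)) fun j => (hp j).2.1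
  have hSlip : ∀ z ∈ paramSpace M Ω amin Δmin, ∀ z' ∈ paramSpace M Ω amin Δmin,
      ∀ w ∈ paramSpace M Ω amin Δmin,
      |sinkhornDiv ε (toMeasure z') (toMeasure w) - sinkhornDiv ε (toMeasure z) (toMeasure w)| ≤
        transportBound D z z' := by
    intro z hz z' hz' w hw
    rw [hD]
    exact abs_sinkhornDiv_sub_le hε hΩ_bdd (hw0 hz) hz.2.1 (hw0 hz') hz'.2.1 (hw0 hw) hw.2.1
  have hgrad : ∀ z ∈ paramSpace M Ω amin Δmin, ∀ m,
      |(shkGrad Ω amin Δmin lam E z).1 m / z.1 m| ≤ D ^ 2 / lam ^ 2 ∧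
      ‖(shkGrad Ω amin Δmin lam E z).2 m‖ ≤ D := fun z hz =>
    shkGrad_bounds hΩ_open ha_min.le hlam hDpos.le hz
      fun z' hz' => (le_abs_self _).trans (hElip z hz z' hz')
  have hgradt := shkGrad_mem_tangentSpace Ω amin Δmin lam E (M := M)
  -- gradient steps of size `t ≤ η` from the basin
  have hmargins : ∀ z ∈ paramSpace M Ω amin Δmin, toMeasure z ∈ B r →
      (∀ m, (⨅ k, (p i).1 k) - τ / 2 ≤ z.1 m) ∧
      distBoundary Ω (p i).2 - δ ≤ distBoundary Ω z.2 ∧ sep (p i).2 - 2 * δ ≤ sep z.2 :=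
    fun z hz hzB => basin_margins hM ha_min hΔ_min hε (hp i) hz hδ hδ₂ hr' ((hBmem hz).1 hzB)
  have hdom : ∀ z ∈ paramSpace M Ω amin Δmin, toMeasure z ∈ B r → ∀ t, 0 ≤ t → t ≤ η →
      -(t • shkGrad Ω amin Δmin lam E z) ∈ retractionDomain Ω amin Δmin z := by
    intro z hz hzB t ht htη
    obtain ⟨h₁, h₂, h₃⟩ := hmargins z hz hzB
    refine neg_smul_mem_retractionDomain ha_min hlam ht (hD ▸ hDpos) hτ₂ (hw0 hz)
      (htη.trans_lt hηret) (fun m => by linarith [h₁ m]) h₂ h₃ (hgradt z)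
      (fun m => hD ▸ (hgrad z hz m).1) (fun m => hD ▸ (hgrad z hz m).2)
  have hpar : ∀ z ∈ paramSpace M Ω amin Δmin, toMeasure z ∈ B r → ∀ t, 0 ≤ t → t ≤ η →
      retraction z (-(t • shkGrad Ω amin Δmin lam E z)) ∈ paramSpace M Ω amin Δmin :=
    fun z hz hzB t ht htη =>
      retraction_mem_paramSpace hΩ_open ha_min hz (hdom z hz hzB t ht htη)
  have hstep : ∀ z ∈ paramSpace M Ω amin Δmin, toMeasure z ∈ B r → ∀ t, 0 ≤ t → t ≤ η →
      transportBound D z (retraction z (-(t • shkGrad Ω amin Δmin lam E z))) ≤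
        gradBound D lam * stepFactor D lam amin η *
          (t * shkNorm lam z (shkGrad Ω amin Δmin lam E z)) := by
    intro z hz hzB t ht htη
    have hz' := hpar z hz hzB t ht htη
    have htan := (hdom z hz hzB t ht htη).1
    rw [← shkNorm_neg_smul lam z _ ht]
    refine transportBound_retraction_le hDpos.le hlam (stepFactor_nonneg _ _ _ _) (hw0 hz) htan
      (hw0 hz') (retraction_weight_le hlam ha_min hη.le hz.1 htan (hw0 hz') fun m => ?_)
    have e : (-(t • shkGrad Ω amin Δmin lam E z)).1 m / z.1 m =
        -(t * ((shkGrad Ω amin Δmin lam E z).1 m / z.1 m)) := by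
      simp only [Prod.fst_neg, Prod.smul_fst, Pi.neg_apply, Pi.smul_apply, smul_eq_mul]
      ring
    rw [e, abs_neg, abs_mul, abs_of_nonneg ht, mul_div_assoc]
    exact mul_le_mul htη (hgrad z hz m).1 (abs_nonneg _) hη.le
  have hgap : ∀ z ∈ paramSpace M Ω amin Δmin, toMeasure z ∈ B r → ∀ t, 0 ≤ t → t ≤ η →
      toMeasure (retraction z (-(t • shkGrad Ω amin Δmin lam E z))) ∈ B r →
      t * shkNorm lam z (shkGrad Ω amin Δmin lam E z) ≤
        Real.sqrt (2 * η * (E (toMeasure z) - Estar)) := by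
    intro z hz hzB t ht htη hB'
    rcases ht.eq_or_lt with rfl | ht
    · rw [zero_mul]; exact Real.sqrt_nonneg _
    have h1 := energy_retraction_le ha_min.le hL hsmooth hz hzB ht (htη.trans hηL.le)
      (hdom z hz hzB t ht.le htη)
    have h2 := hEle _ hB'
    have h3 := hEle _ hzB
    refine Real.le_sqrt_of_sq_le ?_
    have h4 := mul_le_mul_of_nonneg_left (h2.trans h1) ht.le
    have h5 := mul_le_mul_of_nonneg_right htη (sub_nonneg.2 h3)
    nlinarith
  have hcontr : ∀ z ∈ paramSpace M Ω amin Δmin, toMeasure z ∈ B r →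
      E (toMeasure (shkStep Ω amin Δmin lam E η z)) - Estar ≤
        (1 - μ * η) * (E (toMeasure z) - Estar) := by
    intro z hz hzB
    have h1 := energy_retraction_le ha_min.le hL hsmooth hz hzB hη hηL.le
      (hdom z hz hzB η hη.le le_rfl)
    have h2 := mul_le_mul_of_nonneg_left (hPL z hz hzB) hη.le
    rw [← hEstar] at h2
    unfold shkStep
    linarith
  refine ⟨fun z hz hzB => hdom z hz hzB η hη.le le_rfl, fun z ξ hz0 hzs hξ => ?_⟩
  obtain rfl : ξ = fun k => toMeasure (z k) := funext hξ
  clear hξ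
  simp only
  set g₀ := E (toMeasure (z 0)) - Estar with hg₀
  have hsqrt : ∀ {g : ℝ} (k : ℕ), g ≤ (1 - μ * η) ^ k * g₀ →
      Real.sqrt (2 * η * g) ≤ Real.sqrt (2 * η * g₀) * q ^ k := by
    intro g k hg
    rw [← Real.sqrt_sq (pow_pos hq0 k).le, ← Real.sqrt_mul' _ (sq_nonneg _)]
    refine Real.sqrt_le_sqrt ?_
    rw [← pow_mul, mul_comm k 2, pow_mul, hq2]
    have := mul_le_mul_of_nonneg_left hg (show 0 ≤ 2 * η by positivity)
    linarith
  have hmain : (∀ k, toMeasure (z k) ∈ B r) →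
      GeometricBound ε D lam amin μ η g₀ (fun k => toMeasure (z k)) Xs ∧
      WeaklyConvergesIn Ω (fun k => toMeasure (z k)) Xs ∧
      IterationComplexity ε D lam amin μ η g₀ (fun k => toMeasure (z k)) Xs := by
    intro hzB
    have hz : ∀ k, z k ∈ paramSpace M Ω amin Δmin := by
      intro k
      induction k with
      | zero => exact hz0
      | succ k ih =>
        rw [hzs]
        exact hpar _ ih (hzB k) η hη.le le_rfl
    have hg : ∀ k, E (toMeasure (z k)) - Estar ≤ (1 - μ * η) ^ k * g₀ := by
      intro k
      induction k with
      | zero => simp [hg₀]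
      | succ k ih =>
        rw [hzs, pow_succ']
        have := mul_le_mul_of_nonneg_left ih (show 0 ≤ 1 - μ * η by linarith)
        linarith [hcontr _ (hz k) (hzB k)]
    set C := gradBound D lam * stepFactor D lam amin η * Real.sqrt (2 * η * g₀) with hC
    have hinc : ∀ k, transportBound D (z k) (z (k + 1)) ≤ C * q ^ k := by
      intro k
      have h1 := hstep _ (hz k) (hzB k) η hη.le le_rfl
      have h2 := hgap _ (hz k) (hzB k) η hη.le le_rfl (by
        have := hzB (k + 1)
        rwa [hzs] at this)
      rw [hzs, hC, mul_assoc _ (Real.sqrt _)]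
      exact h1.trans (mul_le_mul_of_nonneg_left (h2.trans (hsqrt k (hg k)))
        (mul_nonneg hG.le (stepFactor_nonneg _ _ _ _)))
    -- the particles form a Cauchy sequence; the limit is a minimizer in the basin
    have hcauchy : CauchySeq z := by
      refine cauchySeq_of_le_geometric q ((1 / D ^ 2 + 1 / (D * amin)) * C) hq1 fun k => ?_
      rw [mul_assoc]
      exact (dist_le_transportBound hDpos ha_min (hz k).1 (hz (k + 1)).1).trans
        (mul_le_mul_of_nonneg_left (hinc k) (by positivity))
    obtain ⟨z', hlim⟩ := cauchySeq_tendsto_of_complete hcauchy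
    have hz' : z' ∈ paramSpace M Ω amin Δmin :=
      mem_paramSpace_of_tendsto hΩ_open (a₀ := (⨅ k, (p i).1 k) - τ / 2)
        (d₀ := distBoundary Ω (p i).2 - δ) (s₀ := sep (p i).2 - 2 * δ) (by linarith) (by linarith)
        (by linarith) hlim hz (fun k => (hmargins _ (hz k) (hzB k)).1)
        (fun k => (hmargins _ (hz k) (hzB k)).2.1) fun k => (hmargins _ (hz k) (hzB k)).2.2
    have hSlim : ∀ w ∈ paramSpace M Ω amin Δmin,
        Tendsto (fun k => sinkhornDiv ε (toMeasure (z k)) (toMeasure w)) atTop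
          (𝓝 (sinkhornDiv ε (toMeasure z') (toMeasure w))) := fun w hw =>
      tendsto_of_transportBound (F := fun ν => sinkhornDiv ε ν (toMeasure w))
        (fun k => hSlip _ hz' _ (hz k) w hw) hlim
    have hz'B : toMeasure z' ∈ B r := (hBmem hz').2
      (le_of_tendsto' (hSlim _ (hp i)) fun k => (hBmem (hz k)).1 (hzB k))
    have hEz' : E (toMeasure z') ≤ Estar := by
      have h1 := tendsto_of_transportBound (fun k => hElip _ hz' _ (hz k)) hlim
      have h2 : Tendsto (fun k : ℕ => (1 - μ * η) ^ k * g₀ + Estar) atTop (𝓝 (0 * g₀ + Estar)) :=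
        ((tendsto_pow_atTop_nhds_zero_of_lt_one (by linarith)
          (by linarith [mul_pos hμ hη])).mul_const _).add_const _
      have := le_of_tendsto_of_tendsto' h1 h2 fun k => by linarith [hg k]
      linarith
    have hz'X : toMeasure z' = Xs :=
      hXs.2.2 _ hz'B fun ξ hξ => hEz'.trans (hEle ξ hξ)
    have hgeo : GeometricBound ε D lam amin μ η g₀ (fun k => toMeasure (z k)) Xs := by
      intro k
      have h0 : sinkhornDiv ε (toMeasure z') (toMeasure z') = 0 := by
        unfold sinkhornDiv; ring
      have h1 := le_add_geometric_of_increment_bound hq0.le hq1 (C := C)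
        (u := fun k => sinkhornDiv ε (toMeasure (z k)) (toMeasure z'))
        (fun k => (hSlip _ (hz k) _ (hz (k + 1)) _ hz').trans (hinc k)) (hSlim z' hz') k
      rw [h0, zero_add] at h1
      rw [← hz'X, ← Real.sqrt_eq_rpow, ← hq, mul_comm η μ, rpow_natCast_div_two (by linarith)]
      exact h1
    refine ⟨hgeo, ?_, iterationComplexity_of_geometricBound hDpos ha_min hμ hη hμη
      (sub_nonneg.2 (hEle _ (hzB 0))) hgeo⟩
    rw [← hz'X]
    exact weaklyConvergesIn_of_tendsto hlim (fun k => hw0 (hz k)) (fun k => (hz k).2.1) (hw0 hz')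
      hz'.2.1
  refine ⟨hmain, fun α hα hα1 _ hstart => ?_⟩
  have hg₀pos : 0 < g₀ := by
    by_contra! hcon
    have : alphaRatio D lam amin μ r g₀ ≤ 0 := by
      unfold alphaRatio
      refine mul_nonpos_of_nonneg_of_nonpos (sq_nonneg _)
        (div_nonpos_of_nonneg_of_nonpos (by positivity) ?_)
      exact mul_nonpos_of_nonneg_of_nonpos (by positivity) hcon
    linarith
  set ρ := rhoRadius D lam amin μ η g₀ with hρ
  set C := gradBound D lam * (1 / Real.sqrt amin) * Real.sqrt (2 * η * g₀) with hC
  have hCpos : 0 < C := by positivity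
  have hρC : ρ * (1 - q) = C := by
    have h1 : 1 - q ≠ 0 := by linarith
    have h2 : Real.sqrt amin ≠ 0 := (Real.sqrt_pos.2 ha_min).ne'
    rw [hρ, rhoRadius, ← hq, hC]
    field_simp
  have hρpos : 0 < ρ := by
    by_contra! hcon
    have := mul_nonpos_of_nonpos_of_nonneg hcon (show 0 ≤ 1 - q by linarith)
    linarith
  -- the distance to the pattern after `k` steps is at most `r - ρ q ^ k`
  have hind : ∀ k, z k ∈ paramSpace M Ω amin Δmin ∧
      sinkhornDiv ε (toMeasure (z k)) (toMeasure (p i)) ≤ r - ρ * q ^ k ∧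
      E (toMeasure (z k)) - Estar ≤ (1 - μ * η) ^ k * g₀ := by
    intro k
    induction k with
    | zero =>
      refine ⟨hz0, ?_, by simp [hg₀]⟩
      rw [pow_zero, mul_one]
      exact (hBmem hz0).1 hstart
    | succ k ih =>
      obtain ⟨hz, hS, hg⟩ := ih
      have hρk : 0 < ρ * q ^ (k + 1) := mul_pos hρpos (pow_pos hq0 _)
      have hzB : toMeasure (z k) ∈ B r := (hBmem hz).2 (hS.trans (by
        linarith [mul_pos hρpos (pow_pos hq0 k)]))
      set v := shkGrad Ω amin Δmin lam E (z k) with hv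
      have hφ : ∀ t ∈ Set.Icc 0 η,
          sinkhornDiv ε (toMeasure (retraction (z k) (-(t • v)))) (toMeasure (p i)) ≤ r →
          sinkhornDiv ε (toMeasure (retraction (z k) (-(t • v)))) (toMeasure (p i)) ≤
            r - ρ * q ^ (k + 1) := by
        intro t ht hle
        have hzt := hpar _ hz hzB t ht.1 ht.2
        have h1 := (le_abs_self _).trans (hSlip _ hz _ hzt _ (hp i))
        have h2 := hstep _ hz hzB t ht.1 ht.2
        have h3 := (hgap _ hz hzB t ht.1 ht.2 ((hBmem hzt).2 hle)).trans (hsqrt k hg)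
        have h4 : gradBound D lam * stepFactor D lam amin η *
            (t * shkNorm lam (z k) v) ≤ C * q ^ k := by
          rw [hC, mul_assoc _ (Real.sqrt (2 * η * g₀))]
          refine mul_le_mul (mul_le_mul_of_nonneg_left (min_le_right _ _) hG.le) h3
            (mul_nonneg ht.1 (Real.sqrt_nonneg _)) (by positivity)
        have h5 : ρ * q ^ k - C * q ^ k = ρ * q ^ (k + 1) := by
          rw [← hρC, pow_succ]
          ring
        linarith
      -- by continuity in the step size, the iterate cannot leave the basin
      have hηle : sinkhornDiv ε (toMeasure (retraction (z k) (-(η • v)))) (toMeasure (p i)) ≤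
          r := by
        refine le_of_continuousOn_of_ne
          (φ := fun t => sinkhornDiv ε (toMeasure (retraction (z k) (-(t • v)))) (toMeasure (p i)))
          hη.le ?_ ?_ fun t ht heq => ?_
        · rw [continuousOn_iff_continuous_domRestrict]
          refine continuous_iff_continuousAt.2 fun t₀ => ?_
          refine tendsto_of_transportBound (F := fun ν => sinkhornDiv ε ν (toMeasure (p i)))
            (z := fun t : Set.Icc 0 η => retraction (z k) (-((t : ℝ) • v)))
            (fun t => hSlip _ (hpar _ hz hzB t₀ t₀.2.1 t₀.2.2) _
              (hpar _ hz hzB t t.2.1 t.2.2) _ (hp i)) ?_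
          have hc : Continuous fun t : Set.Icc 0 η => retraction (z k) (-((t : ℝ) • v)) :=
            (continuous_retraction (hw0 hz)).comp (by fun_prop)
          exact hc.tendsto t₀
        · simp only [zero_smul, neg_zero, retraction_zero (hw0 hz)]
          exact (hBmem hz).1 hzB
        · have := hφ t ht heq.le
          linarith
      refine ⟨?_, ?_, ?_⟩
      · rw [hzs]
        exact hpar _ hz hzB η hη.le le_rfl
      · rw [hzs]
        exact hφ η ⟨hη.le, le_rfl⟩ hηle
      · rw [hzs, pow_succ']
        have := mul_le_mul_of_nonneg_left hg (show 0 ≤ 1 - μ * η by linarith)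
        linarith [hcontr _ hz hzB]
  have hall : ∀ k, toMeasure (z k) ∈ B r := fun k => (hBmem (hind k).1).2
    ((hind k).2.1.trans (by linarith [mul_pos hρpos (pow_pos hq0 k)]))
  exact ⟨hall, hmain hall⟩
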